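/- Let $\alpha\le 1$ and let $u$ be a positive radial entire classical solution of $\Delta^2u=u^\alpha$ in $\mathbb R^2$, i.e. $u\in C^4(\mathbb R^2)$, $u>0$, $u$ depends only on $r=|x|$ (we write $u(r)$), and the equation holds at every point of $\mathbb R^2$. For functions $v,f$ of $r$ write $v\sim f$ if $\lim_{r\to\infty} v(r)/f(r)=1$. Put $n=2$. Then: (a) If $\alpha=1$, then $$u\sim \big[u(0)+n\,u''(0)\big]\,\Gamma\!\left(\tfrac n2\right)2^{\frac{n-5}{2}}\pi^{-1/2}\,r^{-\frac{n-1}{2}}e^{r}.$$ (b) If $\alpha\in(-1,1)$, then $$u\sim\Big[\Big(n+\tfrac{4\alpha}{1-\alpha}\Big)\Big(n+\tfrac{4\alpha}{1-\alpha}+2\Big)\Big(\tfrac{4\alpha}{1-\alpha}+2\Big)\Big(\tfrac{4\alpha}{1-\alpha}+4\Big)\Big]^{-\frac1{1-\alpha}}r^{\frac4{1-\alpha}}.$$ (c) If $\alpha=-1$, then $$u\sim 2^{-1/2}\,r^2\ln r\,(\ln\ln r)^{1/2}.$$ (d) If $\alpha<-1$, then $\int_0^\infty t\,u^\alpha(t)\,dt<\infty$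 and $$u\sim\Big(\frac14\int_0^\infty t\,u^\alpha(t)\,dt\Big)\,r^2\ln r.$$ -/

import Mathlib

open Filter Topology

/-- A positive radial (about the origin) entire classical solution `u` of the biharmonic equation
`Δ² u = u ^ α` in `ℝⁿ`. -/
structure IsPositiveRadialSolution (n : ℕ) (α : ℝ) (u : EuclideanSpace ℝ (Fin n) → ℝ) : Prop where
  contDiff : ContDiff ℝ 4 u
  pos : ∀ x, 0 < u x
  radial : ∀ x y, ‖x‖ = ‖y‖ → u x = u y
  equation : ∀ x, Laplacian.laplacian (Laplacian.laplacian u) x = u x ^ α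

/-- The profile of a function `u` on the plane along the first coordinate axis. For a radial `u`
and `r ≥ 0`, this is the value `u(r)` of `u` on the circle `|x| = r`, and the profile is the even
extension of `r ↦ u(r)` to the whole line. -/
noncomputable def radialProfile (u : EuclideanSpace ℝ (Fin 2) → ℝ) (r : ℝ) : ℝ :=
  u (EuclideanSpace.single 0 r)

/-- `v ∼ f` at infinity: the quotient `v(r) / f(r)` tends to `1` as `r → ∞`. -/
def AsympAtInfty (v f : ℝ → ℝ) : Prop :=
  Tendsto (fun r => v r / f r) atTop (𝓝 1)

/-!
A radial function `f` on the plane satisfies `r Δf = (r f')'`, so with `φ = u`, `ψ = Δu`,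
`p = r φ'` and `q = r ψ'` the equation becomes the first order system `RadialSystem`, in which `q`
has derivative `r φ ^ α > 0`. Hence `q` is positive and increasing, `ψ → ∞`, and `φ` grows at least
like `r² log r`. The tool for passing from derivatives to functions is L'Hôpital's rule with a
divergent denominator, `tendsto_div_of_tendsto_deriv_div`, and its one-sided versions.

* `α < -1`: the lower bound on `φ` makes `q` bounded; its limit `M` is `∫ t u ^ α`, and three
  applications of L'Hôpital give `φ / (r² log r) → M / 4`.
* `α = -1`: a finite limit of `q` would give `φ` the growth `r² log r`, and `q' = r / φ` would not be
  integrable; so `q → ∞`. Moreover `q` varies slowly,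
  `φ / (r² ψ) → 1/4` and `ψ / (q log r) → 1`, so that `(q²)' = 2 r q / φ` is asymptotic to
  `8 (log log r)'`.
* `-1 < α < 1`: let `β = 4 / (1 - α)` and let `L r ^ β` be the exact power solution. If
  `|log (φ / (L r ^ β))| ≤ k`, then the right hand side `φ ^ α` is within the factor `exp (|α| k)`
  of that of the power solution, and by comparison for the linear problem `Δ² φ = s` so is `φ`, up
  to the influence of the initial data. This contraction first bounds the logarithm
  (`RadialSystem.exists_eventually_bounds`) and then, iterated, drives it to `0`.
* `α = 1`: `v = u + Δu` solves `Δv = v`, hence is a multiple of the Bessel function `I₀` by a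
  Wronskian argument, while `z = u - Δu` solves `Δz = -z` and is bounded by its energy. Laplace's
  method gives the growth of `I₀`. The multiple is nonzero, since `v = 0` would mean `Δu = -u < 0`,
  against `Δu → ∞`.
-/

/-! ### The Laplacian of a radial function -/

lemma hasDerivAt_along_line {f : EuclideanSpace ℝ (Fin 2) → ℝ} (hf : ContDiff ℝ 2 f)
    (x v : EuclideanSpace ℝ (Fin 2)) (t : ℝ) :
    HasDerivAt (fun t : ℝ => f (x + t • v)) (fderiv ℝ f (x + t • v) v) t := by
  have h1 : HasDerivAt (fun t : ℝ => x + t • v) v t := by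
    simpa using ((hasDerivAt_id t).smul_const v).const_add x
  exact ((hf.differentiable (by norm_num)) (x + t • v)).hasFDerivAt.comp_hasDerivAt t h1

lemma hasDerivAt_fderiv_along_line {f : EuclideanSpace ℝ (Fin 2) → ℝ} (hf : ContDiff ℝ 2 f)
    (x v : EuclideanSpace ℝ (Fin 2)) (t : ℝ) :
    HasDerivAt (fun t : ℝ => fderiv ℝ f (x + t • v) v)
      (fderiv ℝ (fderiv ℝ f) (x + t • v) v v) t := by
  have h1 : HasDerivAt (fun t : ℝ => x + t • v) v t := by
    simpa using ((hasDerivAt_id t).smul_const v).const_add x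
  have h2 : ContDiff ℝ 1 (fderiv ℝ f) := hf.fderiv_right (by norm_num)
  have h3 := ((h2.differentiable (by norm_num)) (x + t • v)).hasFDerivAt.comp_hasDerivAt t h1
  simpa using h3.clm_apply (hasDerivAt_const t v)

lemma laplacian_eq_sum_fderiv (f : EuclideanSpace ℝ (Fin 2) → ℝ)
    (b : OrthonormalBasis (Fin 2) ℝ (EuclideanSpace ℝ (Fin 2)))
    (x : EuclideanSpace ℝ (Fin 2)) :
    Laplacian.laplacian f x = ∑ i, fderiv ℝ (fderiv ℝ f) x (b i) (b i) := by
  rw [InnerProductSpace.laplacian_eq_iteratedFDeriv_orthonormalBasis f b]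
  simp [iteratedFDeriv_two_apply]

lemma contDiff_laplacian {f : EuclideanSpace ℝ (Fin 2) → ℝ} (hf : ContDiff ℝ 4 f) :
    ContDiff ℝ 2 (Laplacian.laplacian f) := by
  have h : Laplacian.laplacian f = fun x => ∑ i, fderiv ℝ (fderiv ℝ f) x
      (EuclideanSpace.basisFun (Fin 2) ℝ i) (EuclideanSpace.basisFun (Fin 2) ℝ i) :=
    funext fun x => laplacian_eq_sum_fderiv f _ x
  have h2 : ContDiff ℝ 2 (fderiv ℝ (fderiv ℝ f)) :=
    (hf.fderiv_right (m := 3) (by norm_num)).fderiv_right (by norm_num)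
  rw [h]
  exact ContDiff.sum fun i _ => (h2.clm_apply contDiff_const).clm_apply contDiff_const

/-- The Laplacian can be computed in any orthonormal basis, so it commutes with isometries; the
reflection exchanging two points of equal norm then shows that it preserves radial symmetry. -/
lemma laplacian_radial {f : EuclideanSpace ℝ (Fin 2) → ℝ} (hf : ContDiff ℝ 2 f)
    (hr : ∀ x y, ‖x‖ = ‖y‖ → f x = f y) (x y : EuclideanSpace ℝ (Fin 2)) (hxy : ‖x‖ = ‖y‖) :
    Laplacian.laplacian f x = Laplacian.laplacian f y := by
  obtain ⟨A, hA⟩ : ∃ A : EuclideanSpace ℝ (Fin 2) ≃ₗᵢ[ℝ] EuclideanSpace ℝ (Fin 2), A x = y :=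
    ⟨_, Submodule.reflection_sub hxy⟩
  set b := EuclideanSpace.basisFun (Fin 2) ℝ
  rw [laplacian_eq_sum_fderiv f b, laplacian_eq_sum_fderiv f (b.map A)]
  refine Finset.sum_congr rfl fun i _ => ?_
  rw [OrthonormalBasis.map_apply]
  have hline : ∀ t : ℝ, f (x + t • b i) = f (y + t • A (b i)) := fun t => by
    refine hr _ _ ?_
    rw [← hA, ← A.map_smul, ← A.map_add, A.norm_map]
  have h1 : ∀ t : ℝ, fderiv ℝ f (x + t • b i) (b i) = fderiv ℝ f (y + t • A (b i)) (A (b i)) :=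
    fun t => (hasDerivAt_along_line hf x (b i) t).unique
      ((hasDerivAt_along_line hf y (A (b i)) t).congr_of_eventuallyEq (Eventually.of_forall hline))
  have h2 := (hasDerivAt_fderiv_along_line hf x (b i) 0).unique
      ((hasDerivAt_fderiv_along_line hf y (A (b i)) 0).congr_of_eventuallyEq
        (Eventually.of_forall h1))
  simpa using h2

lemma single_zero_eq_smul (r : ℝ) :
    (EuclideanSpace.single 0 r : EuclideanSpace ℝ (Fin 2))
      = (0 : EuclideanSpace ℝ (Fin 2)) + r • EuclideanSpace.basisFun (Fin 2) ℝ 0 := by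
  ext i; fin_cases i <;> simp

lemma contDiff_radialProfile {n : WithTop ℕ∞} {f : EuclideanSpace ℝ (Fin 2) → ℝ}
    (hf : ContDiff ℝ n f) : ContDiff ℝ n (radialProfile f) := by
  have : radialProfile f = fun r : ℝ =>
      f ((0 : EuclideanSpace ℝ (Fin 2)) + r • EuclideanSpace.basisFun (Fin 2) ℝ 0) :=
    funext fun r => by rw [radialProfile, single_zero_eq_smul]
  rw [this]
  exact hf.comp (contDiff_const.add (contDiff_id.smul contDiff_const))

lemma deriv_radialProfile {f : EuclideanSpace ℝ (Fin 2) → ℝ} (hf : ContDiff ℝ 2 f) (r : ℝ) :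
    deriv (radialProfile f) r = fderiv ℝ f (0 + r • EuclideanSpace.basisFun (Fin 2) ℝ 0)
      (EuclideanSpace.basisFun (Fin 2) ℝ 0) := by
  have := (hasDerivAt_along_line hf 0 (EuclideanSpace.basisFun (Fin 2) ℝ 0) r).deriv
  rw [← this]
  congr 1
  exact funext fun r => by rw [radialProfile, single_zero_eq_smul]

lemma deriv_deriv_radialProfile {f : EuclideanSpace ℝ (Fin 2) → ℝ} (hf : ContDiff ℝ 2 f)
    (r : ℝ) :
    deriv (deriv (radialProfile f)) r =
      fderiv ℝ (fderiv ℝ f) (0 + r • EuclideanSpace.basisFun (Fin 2) ℝ 0)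
      (EuclideanSpace.basisFun (Fin 2) ℝ 0) (EuclideanSpace.basisFun (Fin 2) ℝ 0) := by
  rw [← (hasDerivAt_fderiv_along_line hf 0 (EuclideanSpace.basisFun (Fin 2) ℝ 0) r).deriv]
  congr 1
  exact funext fun r => deriv_radialProfile hf r

lemma norm_single_add (r t : ℝ) :
    ‖(EuclideanSpace.single 0 r : EuclideanSpace ℝ (Fin 2))
      + t • EuclideanSpace.basisFun (Fin 2) ℝ 1‖ = √(r ^ 2 + t ^ 2) := by
  rw [EuclideanSpace.norm_eq]
  simp [Fin.sum_univ_two]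

/-- The line through `r e₀` in the direction `e₁` meets the circle of radius `√(r² + t²)`, so the
transverse second derivative of a radial function is `f'(r) / r`. -/
lemma radial_transverse_deriv {f : EuclideanSpace ℝ (Fin 2) → ℝ} (hf : ContDiff ℝ 2 f)
    (hr : ∀ x y, ‖x‖ = ‖y‖ → f x = f y) {r : ℝ} (hr0 : 0 < r) :
    fderiv ℝ (fderiv ℝ f) (EuclideanSpace.single 0 r) (EuclideanSpace.basisFun (Fin 2) ℝ 1)
      (EuclideanSpace.basisFun (Fin 2) ℝ 1) = deriv (radialProfile f) r / r := by
  set e := EuclideanSpace.basisFun (Fin 2) ℝ 1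
  have hP := contDiff_radialProfile hf
  have hP1 : Differentiable ℝ (radialProfile f) := hP.differentiable (by norm_num)
  have hP2 : Differentiable ℝ (deriv (radialProfile f)) :=
    hP.differentiable_deriv_two
  have hpos : ∀ t : ℝ, r ^ 2 + t ^ 2 ≠ 0 := fun t => by positivity
  have hline : ∀ t : ℝ, f (EuclideanSpace.single 0 r + t • e)
      = radialProfile f (√(r ^ 2 + t ^ 2)) := fun t => by
    refine hr _ _ ?_
    rw [norm_single_add]
    simp [abs_of_nonneg (Real.sqrt_nonneg _)]
  have hs : ∀ t : ℝ, HasDerivAt (fun t : ℝ => √(r ^ 2 + t ^ 2)) (t / √(r ^ 2 + t ^ 2)) t :=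
    fun t => by
      have := ((hasDerivAt_pow 2 t).const_add (r ^ 2)).sqrt (hpos t)
      refine this.congr_deriv ?_
      norm_num
      field_simp
  have h1 : ∀ t : ℝ, fderiv ℝ f (EuclideanSpace.single 0 r + t • e) e
      = t * (deriv (radialProfile f) (√(r ^ 2 + t ^ 2)) / √(r ^ 2 + t ^ 2)) := fun t => by
    have h2 := (hP1 (√(r ^ 2 + t ^ 2))).hasDerivAt.comp t (hs t)
    have h3 := (hasDerivAt_along_line hf (EuclideanSpace.single 0 r) e t).unique
      (h2.congr_of_eventuallyEq (Eventually.of_forall hline))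
    rw [h3]; ring
  have hm : DifferentiableAt ℝ
      (fun t : ℝ => deriv (radialProfile f) (√(r ^ 2 + t ^ 2)) / √(r ^ 2 + t ^ 2)) 0 := by
    refine DifferentiableAt.div ?_ (hs 0).differentiableAt ?_
    · exact (hP2 _).comp (0 : ℝ) (hs 0).differentiableAt
    · exact (Real.sqrt_pos.2 (by positivity)).ne'
  have h4 := (hasDerivAt_fderiv_along_line hf (EuclideanSpace.single 0 r) e 0).unique
    (((hasDerivAt_id (0 : ℝ)).mul hm.hasDerivAt).congr_of_eventuallyEq
      (Eventually.of_forall h1))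
  simpa [Real.sqrt_sq hr0.le] using h4

lemma laplacian_radial_eq {f : EuclideanSpace ℝ (Fin 2) → ℝ} (hf : ContDiff ℝ 2 f)
    (hr : ∀ x y, ‖x‖ = ‖y‖ → f x = f y) {r : ℝ} (hr0 : 0 < r) :
    radialProfile (Laplacian.laplacian f) r
      = deriv (deriv (radialProfile f)) r + deriv (radialProfile f) r / r := by
  rw [radialProfile, laplacian_eq_sum_fderiv f (EuclideanSpace.basisFun (Fin 2) ℝ),
    Fin.sum_univ_two, radial_transverse_deriv hf hr hr0, deriv_deriv_radialProfile hf,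
    single_zero_eq_smul]

lemma laplacian_radial_zero {f : EuclideanSpace ℝ (Fin 2) → ℝ} (hf : ContDiff ℝ 2 f)
    (hr : ∀ x y, ‖x‖ = ‖y‖ → f x = f y) :
    radialProfile (Laplacian.laplacian f) 0 = 2 * deriv (deriv (radialProfile f)) 0 := by
  set b := EuclideanSpace.basisFun (Fin 2) ℝ
  have hline : ∀ t : ℝ, f (0 + t • b 0) = f (0 + t • b 1) := fun t => by
    refine hr _ _ ?_
    simp [norm_smul]
  have h1 : ∀ t : ℝ, fderiv ℝ f (0 + t • b 0) (b 0) = fderiv ℝ f (0 + t • b 1) (b 1) :=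
    fun t => (hasDerivAt_along_line hf 0 (b 0) t).unique
      ((hasDerivAt_along_line hf 0 (b 1) t).congr_of_eventuallyEq (Eventually.of_forall hline))
  have h2 := (hasDerivAt_fderiv_along_line hf 0 (b 0) 0).unique
      ((hasDerivAt_fderiv_along_line hf 0 (b 1) 0).congr_of_eventuallyEq
        (Eventually.of_forall h1))
  rw [radialProfile, laplacian_eq_sum_fderiv f b, Fin.sum_univ_two,
    deriv_deriv_radialProfile hf, single_zero_eq_smul]
  simp only [zero_smul, add_zero] at h2 ⊢
  rw [← h2]; ring

lemma hasDerivAt_mul_deriv_radialProfile {f : EuclideanSpace ℝ (Fin 2) → ℝ}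
    (hf : ContDiff ℝ 2 f) (hr : ∀ x y, ‖x‖ = ‖y‖ → f x = f y) {r : ℝ} (hr0 : 0 < r) :
    HasDerivAt (fun r => r * deriv (radialProfile f) r)
      (r * radialProfile (Laplacian.laplacian f) r) r := by
  have hP2 : Differentiable ℝ (deriv (radialProfile f)) :=
    (contDiff_radialProfile hf).differentiable_deriv_two
  refine ((hasDerivAt_id r).mul (hP2 r).hasDerivAt).congr_deriv ?_
  rw [laplacian_radial_eq hf hr hr0]
  simp only [id]
  field_simp
  ring

/-- The radial form of `Δ² u = u ^ α` in the plane, as a first order system on `r > 0` with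
`φ = u`, `ψ = Δ u`, `p = r u'` and `q = r (Δ u)'`. -/
structure RadialSystem (α : ℝ) (φ ψ p q : ℝ → ℝ) : Prop where
  pos : ∀ r, 0 < φ r
  cont_φ : Continuous φ
  cont_ψ : Continuous ψ
  cont_p : Continuous p
  cont_q : Continuous q
  p_zero : p 0 = 0
  q_zero : q 0 = 0
  deriv_φ : ∀ r, 0 < r → HasDerivAt φ (p r / r) r
  deriv_p : ∀ r, 0 < r → HasDerivAt p (r * ψ r) r
  deriv_ψ : ∀ r, 0 < r → HasDerivAt ψ (q r / r) r
  deriv_q : ∀ r, 0 < r → HasDerivAt q (r * φ r ^ α) r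

/-- The profile of a solution is part of a solution of the radial system; moreover
`Δu(0) = 2 u''(0)`, because both second partial derivatives agree at the origin. -/
theorem IsPositiveRadialSolution.exists_radialSystem {α : ℝ}
    {u : EuclideanSpace ℝ (Fin 2) → ℝ} (hu : IsPositiveRadialSolution 2 α u) :
    ∃ ψ p q : ℝ → ℝ, RadialSystem α (radialProfile u) ψ p q ∧
      ψ 0 = 2 * iteratedDeriv 2 (radialProfile u) 0 := by
  have hu2 : ContDiff ℝ 2 u := hu.contDiff.of_le (by norm_num)
  have hw2 := contDiff_laplacian hu.contDiff
  have hwr := laplacian_radial hu2 hu.radial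
  have hφ := contDiff_radialProfile hu2
  have hψ := contDiff_radialProfile hw2
  refine ⟨radialProfile (Laplacian.laplacian u), fun r => r * deriv (radialProfile u) r,
    fun r => r * deriv (radialProfile (Laplacian.laplacian u)) r, ⟨fun r => hu.pos _,
    hφ.continuous, hψ.continuous, continuous_id.mul (hφ.continuous_deriv (by norm_num)),
    continuous_id.mul (hψ.continuous_deriv (by norm_num)), by simp, by simp, fun r hr => ?_,
    fun r hr => hasDerivAt_mul_deriv_radialProfile hu2 hu.radial hr, fun r hr => ?_,
    fun r hr => ?_⟩, ?_⟩
  · refine ((hφ.differentiable (by norm_num)) r).hasDerivAt.congr_deriv ?_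
    field_simp
  · refine ((hψ.differentiable (by norm_num)) r).hasDerivAt.congr_deriv ?_
    field_simp
  · refine (hasDerivAt_mul_deriv_radialProfile hw2 hwr hr).congr_deriv ?_
    simp only [radialProfile, hu.equation]
  · rw [laplacian_radial_zero hu2 hu.radial, iteratedDeriv_succ, iteratedDeriv_one]

/-! ### Integrating differential inequalities up to infinity -/

lemma sub_le_sub_of_hasDerivAt_le {f g f' g' : ℝ → ℝ} {a b : ℝ} (hab : a ≤ b)
    (hfc : ContinuousOn f (Set.Icc a b)) (hgc : ContinuousOn g (Set.Icc a b))
    (hf : ∀ x ∈ Set.Ioo a b, HasDerivAt f (f' x) x)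
    (hg : ∀ x ∈ Set.Ioo a b, HasDerivAt g (g' x) x)
    (hle : ∀ x ∈ Set.Ioo a b, f' x ≤ g' x) : f b - f a ≤ g b - g a := by
  have hm : MonotoneOn (fun x => g x - f x) (Set.Icc a b) := by
    refine monotoneOn_of_deriv_nonneg (convex_Icc a b) (hgc.sub hfc) ?_ ?_
    · rw [interior_Icc]
      exact fun x hx => ((hg x hx).sub (hf x hx)).differentiableAt.differentiableWithinAt
    · rw [interior_Icc]
      intro x hx
      have h := ((hg x hx).sub (hf x hx)).deriv
      have h' : deriv (fun x => g x - f x) x = g' x - f' x := h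
      rw [h']
      exact sub_nonneg.2 (hle x hx)
  have := hm (Set.left_mem_Icc.2 hab) (Set.right_mem_Icc.2 hab) hab
  simp only at this
  linarith

lemma eventually_le_mul_of_deriv_le {f g f' g' : ℝ → ℝ} {c c' : ℝ} (hcc : c < c')
    (hf : ∀ᶠ x in atTop, HasDerivAt f (f' x) x) (hg : ∀ᶠ x in atTop, HasDerivAt g (g' x) x)
    (hgt : Tendsto g atTop atTop) (hle : ∀ᶠ x in atTop, f' x ≤ c * g' x) :
    ∀ᶠ x in atTop, f x ≤ c' * g x := by
  obtain ⟨a, ha⟩ := eventually_atTop.1 (hf.and (hg.and hle))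
  filter_upwards [eventually_ge_atTop a,
    hgt.eventually_ge_atTop ((f a - c * g a) / (c' - c))] with x hx hgx
  have h := sub_le_sub_of_hasDerivAt_le (f := f) (g := fun x => c * g x) hx
    (fun y hy => (ha y hy.1).1.continuousAt.continuousWithinAt)
    (fun y hy => ((ha y hy.1).2.1.const_mul c).continuousAt.continuousWithinAt)
    (fun y hy => (ha y hy.1.le).1) (fun y hy => (ha y hy.1.le).2.1.const_mul c)
    (fun y hy => (ha y hy.1.le).2.2)
  rw [div_le_iff₀ (by linarith)] at hgx
  linarith

lemma eventually_mul_le_of_le_deriv {f g f' g' : ℝ → ℝ} {c c' : ℝ} (hcc : c' < c)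
    (hf : ∀ᶠ x in atTop, HasDerivAt f (f' x) x) (hg : ∀ᶠ x in atTop, HasDerivAt g (g' x) x)
    (hgt : Tendsto g atTop atTop) (hle : ∀ᶠ x in atTop, c * g' x ≤ f' x) :
    ∀ᶠ x in atTop, c' * g x ≤ f x := by
  have h := eventually_le_mul_of_deriv_le (neg_lt_neg hcc) (hf.mono fun x hx => hx.neg) hg hgt
    (hle.mono fun x hx => by rw [neg_mul]; exact neg_le_neg hx)
  filter_upwards [h] with x hx
  simp only [Pi.neg_apply, neg_mul] at hx
  linarith

/-- L'Hôpital's rule at infinity when only the denominator is known to diverge. -/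
lemma tendsto_div_of_tendsto_deriv_div {f g f' g' : ℝ → ℝ} {l : ℝ}
    (hf : ∀ᶠ x in atTop, HasDerivAt f (f' x) x) (hg : ∀ᶠ x in atTop, HasDerivAt g (g' x) x)
    (hgt : Tendsto g atTop atTop) (hpos : ∀ᶠ x in atTop, 0 < g' x)
    (hl : Tendsto (fun x => f' x / g' x) atTop (𝓝 l)) :
    Tendsto (fun x => f x / g x) atTop (𝓝 l) := by
  refine tendsto_order.2 ⟨fun a ha => ?_, fun b hb => ?_⟩
  · obtain ⟨c, hac, hcl⟩ := exists_between ha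
    obtain ⟨d, had, hdc⟩ := exists_between hac
    have h := eventually_mul_le_of_le_deriv hdc hf hg hgt (by
      filter_upwards [hpos, hl.eventually_const_lt hcl] with x h1 h2
      exact ((lt_div_iff₀ h1).1 h2).le)
    filter_upwards [h, hgt.eventually_gt_atTop 0] with x h1 h2
    exact had.trans_le ((le_div_iff₀ h2).2 h1)
  · obtain ⟨c, hlc, hcb⟩ := exists_between hb
    obtain ⟨d, hcd, hdb⟩ := exists_between hcb
    have h := eventually_le_mul_of_deriv_le hcd hf hg hgt (by
      filter_upwards [hpos, hl.eventually_lt_const hlc] with x h1 h2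
      exact ((div_lt_iff₀ h1).1 h2).le)
    filter_upwards [h, hgt.eventually_gt_atTop 0] with x h1 h2
    exact ((div_le_iff₀ h2).2 h1).trans_lt hdb

lemma hasDerivAt_sq_mul_log {r : ℝ} (hr : 0 < r) :
    HasDerivAt (fun r : ℝ => r ^ 2 * Real.log r) (2 * r * Real.log r + r) r := by
  refine ((hasDerivAt_pow 2 r).mul (Real.hasDerivAt_log hr.ne')).congr_deriv ?_
  norm_num
  field_simp

lemma tendsto_sq_mul_log : Tendsto (fun r : ℝ => r ^ 2 * Real.log r) atTop atTop :=
  (tendsto_pow_atTop (by norm_num)).atTop_mul_atTop₀ Real.tendsto_log_atTop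

/-! ### Growth of solutions of the radial system -/

namespace RadialSystem

variable {α : ℝ} {φ ψ p q : ℝ → ℝ}

lemma q_strictMonoOn (h : RadialSystem α φ ψ p q) : StrictMonoOn q (Set.Ici 0) := by
  refine strictMonoOn_of_deriv_pos (convex_Ici 0) h.cont_q.continuousOn fun r hr => ?_
  rw [interior_Ici] at hr
  rw [(h.deriv_q r hr).deriv]
  exact mul_pos hr (Real.rpow_pos_of_pos (h.pos r) _)

lemma q_pos (h : RadialSystem α φ ψ p q) {r : ℝ} (hr : 0 < r) : 0 < q r := by
  have := h.q_strictMonoOn (Set.mem_Ici.2 le_rfl) (Set.mem_Ici.2 hr.le) hr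
  rwa [h.q_zero] at this

lemma q_le (h : RadialSystem α φ ψ p q) {r s : ℝ} (hr : 0 ≤ r) (hrs : r ≤ s) : q r ≤ q s :=
  h.q_strictMonoOn.monotoneOn (Set.mem_Ici.2 hr) (Set.mem_Ici.2 (hr.trans hrs)) hrs

lemma ev_φ (h : RadialSystem α φ ψ p q) : ∀ᶠ r in atTop, HasDerivAt φ (p r / r) r :=
  (eventually_gt_atTop 0).mono h.deriv_φ
lemma ev_p (h : RadialSystem α φ ψ p q) : ∀ᶠ r in atTop, HasDerivAt p (r * ψ r) r :=
  (eventually_gt_atTop 0).mono h.deriv_p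
lemma ev_ψ (h : RadialSystem α φ ψ p q) : ∀ᶠ r in atTop, HasDerivAt ψ (q r / r) r :=
  (eventually_gt_atTop 0).mono h.deriv_ψ
lemma ev_q (h : RadialSystem α φ ψ p q) : ∀ᶠ r in atTop, HasDerivAt q (r * φ r ^ α) r :=
  (eventually_gt_atTop 0).mono h.deriv_q

/-- Since `q = r ψ'` is positive and increasing, `ψ` grows at least like `log r`. -/
lemma exists_log_le_ψ (h : RadialSystem α φ ψ p q) :
    ∃ c > 0, ∀ᶠ r in atTop, c * Real.log r ≤ ψ r := by
  have h1 := h.q_pos one_pos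
  refine ⟨q 1 / 2, by positivity, ?_⟩
  refine eventually_mul_le_of_le_deriv (half_lt_self h1) h.ev_ψ
    ((eventually_gt_atTop 0).mono fun r hr => Real.hasDerivAt_log (ne_of_gt hr))
    Real.tendsto_log_atTop ?_
  filter_upwards [eventually_ge_atTop 1] with r hr
  rw [← div_eq_mul_inv]
  exact div_le_div_of_nonneg_right (h.q_le zero_le_one hr) (by linarith)

lemma tendsto_ψ (h : RadialSystem α φ ψ p q) : Tendsto ψ atTop atTop := by
  obtain ⟨c, hc, hle⟩ := h.exists_log_le_ψ
  exact tendsto_atTop_mono' _ hle (Real.tendsto_log_atTop.const_mul_atTop hc)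

lemma exists_sq_mul_log_le_p (h : RadialSystem α φ ψ p q) :
    ∃ c > 0, ∀ᶠ r in atTop, c * (r ^ 2 * Real.log r) ≤ p r := by
  obtain ⟨c, hc, hle⟩ := h.exists_log_le_ψ
  refine ⟨c / 6, by positivity, ?_⟩
  refine eventually_mul_le_of_le_deriv (c := c / 3) (by linarith) h.ev_p
    ((eventually_gt_atTop 0).mono fun r hr => hasDerivAt_sq_mul_log hr) tendsto_sq_mul_log ?_
  filter_upwards [hle, eventually_gt_atTop 0, Real.tendsto_log_atTop.eventually_ge_atTop 1]
    with r h1 h2 h3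
  have h4 : r * (c * Real.log r) ≤ r * ψ r := mul_le_mul_of_nonneg_left h1 h2.le
  have h5 : c * r * 1 ≤ c * r * Real.log r := mul_le_mul_of_nonneg_left h3 (by positivity)
  nlinarith

lemma exists_sq_mul_log_le_φ (h : RadialSystem α φ ψ p q) :
    ∃ c > 0, ∀ᶠ r in atTop, c * (r ^ 2 * Real.log r) ≤ φ r := by
  obtain ⟨c, hc, hle⟩ := h.exists_sq_mul_log_le_p
  refine ⟨c / 6, by positivity, ?_⟩
  refine eventually_mul_le_of_le_deriv (c := c / 3) (by linarith) h.ev_φ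
    ((eventually_gt_atTop 0).mono fun r hr => hasDerivAt_sq_mul_log hr) tendsto_sq_mul_log ?_
  filter_upwards [hle, eventually_gt_atTop 0, Real.tendsto_log_atTop.eventually_ge_atTop 1]
    with r h1 h2 h3
  rw [le_div_iff₀ h2]
  have h5 : c * r ^ 2 * 1 ≤ c * r ^ 2 * Real.log r := mul_le_mul_of_nonneg_left h3 (by positivity)
  nlinarith

end RadialSystem

namespace RadialSystem

variable {α : ℝ} {φ ψ p q : ℝ → ℝ}

/-! ### Solutions of growth `r² log r`: exponents below `-1` -/

lemma tendsto_q (h : RadialSystem α φ ψ p q) :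
    Tendsto q atTop atTop ∨ ∃ M > 0, Tendsto q atTop (𝓝 M) := by
  have hmono : Monotone fun r => q (max 0 r) := fun r s hrs =>
    h.q_le (le_max_left _ _) (max_le_max_left 0 hrs)
  have heq : (fun r => q (max 0 r)) =ᶠ[atTop] q := by
    filter_upwards [eventually_ge_atTop 0] with r hr
    rw [max_eq_right hr]
  rcases tendsto_atTop_of_monotone hmono with h1 | ⟨M, hM⟩
  · exact Or.inl (h1.congr' heq)
  · have hM' := hM.congr' heq
    refine Or.inr ⟨M, (h.q_pos one_pos).trans_le (ge_of_tendsto hM' ?_), hM'⟩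
    filter_upwards [eventually_ge_atTop 1] with r hr using h.q_le zero_le_one hr

lemma tendsto_φ_div_sq_mul_log (h : RadialSystem α φ ψ p q) {M : ℝ}
    (hq : Tendsto q atTop (𝓝 M)) :
    Tendsto (fun r => φ r / (r ^ 2 * Real.log r)) atTop (𝓝 (M / 4)) := by
  have hψ : Tendsto (fun r => ψ r / Real.log r) atTop (𝓝 M) := by
    refine tendsto_div_of_tendsto_deriv_div h.ev_ψ
      ((eventually_gt_atTop 0).mono fun r hr => Real.hasDerivAt_log (ne_of_gt hr))
      Real.tendsto_log_atTop ((eventually_gt_atTop 0).mono fun r hr => inv_pos.2 hr) ?_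
    refine hq.congr' ?_
    filter_upwards [eventually_gt_atTop 0] with r hr
    field_simp
  have hden : Tendsto (fun r => 2 + (Real.log r)⁻¹) atTop (𝓝 2) := by
    simpa using (tendsto_inv_atTop_zero.comp Real.tendsto_log_atTop).const_add 2
  have hderiv : ∀ᶠ r : ℝ in atTop,
      HasDerivAt (fun r : ℝ => r ^ 2 * Real.log r) (2 * r * Real.log r + r) r :=
    (eventually_gt_atTop 0).mono fun r hr => hasDerivAt_sq_mul_log hr
  have hpos : ∀ᶠ r : ℝ in atTop, 0 < 2 * r * Real.log r + r := by
    filter_upwards [eventually_gt_atTop 1] with r hr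
    have := Real.log_pos hr
    positivity
  have hp : Tendsto (fun r => p r / (r ^ 2 * Real.log r)) atTop (𝓝 (M / 2)) := by
    refine tendsto_div_of_tendsto_deriv_div h.ev_p hderiv tendsto_sq_mul_log hpos ?_
    refine (hψ.div hden two_ne_zero).congr' ?_
    filter_upwards [eventually_gt_atTop 1] with r hr
    have := Real.log_pos hr
    simp only [Pi.div_apply]
    field_simp
  refine tendsto_div_of_tendsto_deriv_div h.ev_φ hderiv tendsto_sq_mul_log hpos ?_
  have h4 : M / 4 = M / 2 / 2 := by ring
  rw [h4]
  refine (hp.div hden two_ne_zero).congr' ?_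
  filter_upwards [eventually_gt_atTop 1] with r hr
  have := Real.log_pos hr
  simp only [Pi.div_apply]
  field_simp

/-- For `α < -1` the lower bound `φ ≥ c r²` makes `q' = r φ ^ α` integrable at infinity. -/
lemma exists_tendsto_q (h : RadialSystem α φ ψ p q) (hα : α < -1) :
    ∃ M > 0, Tendsto q atTop (𝓝 M) := by
  refine h.tendsto_q.resolve_left fun htop => ?_
  obtain ⟨c, hc, hle⟩ := h.exists_sq_mul_log_le_φ
  have hbound : ∀ᶠ r in atTop, r * φ r ^ α ≤ c ^ α * r ^ (2 * α + 1) := by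
    filter_upwards [hle, eventually_gt_atTop 0, Real.tendsto_log_atTop.eventually_ge_atTop 1]
      with r h1 h2 h3
    have h4 : c * r ^ 2 ≤ φ r := by
      refine le_trans ?_ h1
      have : c * r ^ 2 * 1 ≤ c * r ^ 2 * Real.log r :=
        mul_le_mul_of_nonneg_left h3 (by positivity)
      linarith
    have h5 : φ r ^ α ≤ (c * r ^ 2) ^ α :=
      Real.rpow_le_rpow_of_nonpos (by positivity) h4 (by linarith)
    have h6 : (c * r ^ 2) ^ α = c ^ α * r ^ (2 * α) := by
      rw [Real.mul_rpow hc.le (by positivity), Real.rpow_mul h2.le, Real.rpow_two]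
    rw [Real.rpow_add_one h2.ne']
    calc r * φ r ^ α ≤ r * (c ^ α * r ^ (2 * α)) := by
          rw [← h6]; exact mul_le_mul_of_nonneg_left h5 h2.le
      _ = _ := by ring
  obtain ⟨a, ha⟩ := eventually_atTop.1 (hbound.and (eventually_gt_atTop 0))
  have hg : ∀ x : ℝ, 0 < x → HasDerivAt (fun x : ℝ => c ^ α / (2 * α + 2) * x ^ (2 * α + 2))
      (c ^ α * x ^ (2 * α + 1)) x := fun x hx => by
    refine ((Real.hasDerivAt_rpow_const (Or.inl hx.ne')).const_mul _).congr_deriv ?_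
    have : 2 * α + 2 ≠ 0 := by linarith
    have h1 : 2 * α + 2 - 1 = 2 * α + 1 := by ring
    rw [h1, ← mul_assoc, div_mul_cancel₀ _ this]
  obtain ⟨r, hr1, hr2⟩ := ((htop.eventually_gt_atTop
    (q a - c ^ α / (2 * α + 2) * a ^ (2 * α + 2))).and (eventually_ge_atTop a)).exists
  have ha0 : 0 < a := (ha a le_rfl).2
  have hr0 : 0 < r := ha0.trans_le hr2
  have key := sub_le_sub_of_hasDerivAt_le (f := q) hr2 h.cont_q.continuousOn
    (fun x hx => (hg x (ha0.trans_le hx.1)).continuousAt.continuousWithinAt)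
    (fun x hx => h.deriv_q x (ha0.trans hx.1))
    (fun x hx => hg x (ha0.trans hx.1)) (fun x hx => (ha x hx.1.le).1)
  have hneg : c ^ α / (2 * α + 2) * r ^ (2 * α + 2) ≤ 0 :=
    mul_nonpos_of_nonpos_of_nonneg
      (div_nonpos_of_nonneg_of_nonpos (by positivity) (by linarith)) (by positivity)
  linarith

theorem asymp_of_lt_neg_one (h : RadialSystem α φ ψ p q) (hα : α < -1) :
    MeasureTheory.IntegrableOn (fun t => t * φ t ^ α) (Set.Ioi 0) ∧
      AsympAtInfty φ fun r => (1 / 4 * ∫ t in Set.Ioi (0 : ℝ), t * φ t ^ α) * r ^ 2 * Real.log r := by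
  obtain ⟨M, hM0, hM⟩ := h.exists_tendsto_q hα
  have hnn : ∀ x ∈ Set.Ioi (0 : ℝ), 0 ≤ x * φ x ^ α := fun x hx =>
    mul_nonneg (le_of_lt hx) (Real.rpow_nonneg (h.pos x).le _)
  have hc : ContinuousWithinAt q (Set.Ici 0) 0 := h.cont_q.continuousWithinAt
  refine ⟨MeasureTheory.integrableOn_Ioi_deriv_of_nonneg hc h.deriv_q hnn hM, ?_⟩
  rw [MeasureTheory.integral_Ioi_of_hasDerivAt_of_nonneg hc h.deriv_q hnn hM, h.q_zero, sub_zero]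
  have h4 : M / 4 ≠ 0 := by positivity
  have := (h.tendsto_φ_div_sq_mul_log hM).div_const (M / 4)
  rw [div_self h4] at this
  refine this.congr fun r => ?_
  rw [div_div]
  congr 1
  ring

/-! ### The critical exponent `-1` -/

lemma hasDerivAt_log_log {r : ℝ} (hr : 1 < r) :
    HasDerivAt (fun r => Real.log (Real.log r)) (1 / (r * Real.log r)) r := by
  have := (Real.hasDerivAt_log (by linarith : r ≠ 0)).log (Real.log_pos hr).ne'
  refine this.congr_deriv ?_
  have h1 := Real.log_pos hr
  field_simp

lemma tendsto_log_log : Tendsto (fun r => Real.log (Real.log r)) atTop atTop :=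
  Real.tendsto_log_atTop.comp Real.tendsto_log_atTop

/-- A finite limit of `q` would give `φ` the growth `r² log r`, so that `q' = r / φ` would dominate
a multiple of `(log log r)'`, which is not integrable. -/
lemma tendsto_q_atTop_of_neg_one (h : RadialSystem (-1) φ ψ p q) : Tendsto q atTop atTop := by
  refine h.tendsto_q.resolve_right ?_
  rintro ⟨M, hM0, hM⟩
  have hφ := (h.tendsto_φ_div_sq_mul_log hM).eventually_lt_const (show M / 4 < M by linarith)
  have hlow := eventually_mul_le_of_le_deriv (c := 1 / M) (c' := 1 / (2 * M))
    (one_div_lt_one_div_of_lt hM0 (by linarith)) h.ev_q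
    ((eventually_gt_atTop 1).mono fun r hr => hasDerivAt_log_log hr) tendsto_log_log (by
      filter_upwards [hφ, eventually_gt_atTop 1] with r h1 h2
      have h3 := Real.log_pos h2
      have h4 := h.pos r
      rw [div_lt_iff₀ (by positivity)] at h1
      rw [Real.rpow_neg_one, ← div_eq_mul_inv, div_mul_div_comm, one_mul,
        div_le_div_iff₀ (by positivity) h4]
      nlinarith)
  exact not_tendsto_nhds_of_tendsto_atTop
    (tendsto_atTop_mono' _ hlow (tendsto_log_log.const_mul_atTop (by positivity))) M hM

/-- For `α = -1` the quantity `q` varies slowly, hence `φ ≈ r² ψ / 4` and `ψ ≈ q log r`; feeding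
this into `q' = r / φ` gives `(q²)' ≈ 8 (log log r)'`. -/
theorem asymp_of_eq_neg_one (h : RadialSystem (-1) φ ψ p q) :
    AsympAtInfty φ fun r => (2 : ℝ) ^ (-(1 : ℝ) / 2) * r ^ 2 * Real.log r
          * (Real.log (Real.log r)) ^ ((1 : ℝ) / 2) := by
  have hqt := h.tendsto_q_atTop_of_neg_one
  obtain ⟨c, hc, hφlow⟩ := h.exists_sq_mul_log_le_φ
  have hψpos : ∀ᶠ r in atTop, 0 < ψ r := h.tendsto_ψ.eventually_gt_atTop 0
  -- In the variable `log r` this is the logarithmic derivative `(log r) q' / q`: `q` varies slowly.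
  have hden0 : Tendsto (fun r => r ^ 2 * Real.log r / (φ r * q r)) atTop (𝓝 0) := by
    refine squeeze_zero' (g := fun r => c⁻¹ * (q r)⁻¹) ?_ ?_ (by
      simpa using (tendsto_inv_atTop_zero.comp hqt).const_mul c⁻¹)
    · filter_upwards [eventually_gt_atTop 1] with r hr
      have := Real.log_pos hr
      have := h.pos r
      have := h.q_pos (zero_lt_one.trans hr)
      positivity
    · filter_upwards [eventually_gt_atTop 1, hφlow] with r hr h1
      have h2 := h.pos r
      have h3 := h.q_pos (zero_lt_one.trans hr)
      rw [← mul_inv, ← one_div, div_le_div_iff₀ (by positivity) (by positivity)]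
      nlinarith
  have hqψ : Tendsto (fun r => q r / ψ r) atTop (𝓝 0) := by
    refine tendsto_div_of_tendsto_deriv_div h.ev_q h.ev_ψ h.tendsto_ψ ?_ ?_
    · filter_upwards [eventually_gt_atTop 0] with r hr using div_pos (h.q_pos hr) hr
    · have := hden0.mul (tendsto_inv_atTop_zero.comp Real.tendsto_log_atTop)
      rw [zero_mul] at this
      refine this.congr' ?_
      filter_upwards [eventually_gt_atTop 1] with r hr
      have := Real.log_pos hr
      have := h.pos r
      have := h.q_pos (zero_lt_one.trans hr)
      simp only [Function.comp, Real.rpow_neg_one]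
      field_simp
  have hg : ∀ᶠ r in atTop, HasDerivAt (fun r => r ^ 2 * ψ r) (2 * r * ψ r + r * q r) r := by
    filter_upwards [eventually_gt_atTop 0] with r hr
    refine ((hasDerivAt_pow 2 r).mul (h.deriv_ψ r hr)).congr_deriv ?_
    norm_num
    field_simp
  have hgt : Tendsto (fun r => r ^ 2 * ψ r) atTop atTop :=
    (tendsto_pow_atTop two_ne_zero).atTop_mul_atTop₀ h.tendsto_ψ
  have hgpos : ∀ᶠ r in atTop, 0 < 2 * r * ψ r + r * q r := by
    filter_upwards [eventually_gt_atTop 0, hψpos] with r hr h1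
    have := h.q_pos hr
    positivity
  have hden : Tendsto (fun r => 2 + q r / ψ r) atTop (𝓝 2) := by simpa using hqψ.const_add 2
  have hp : Tendsto (fun r => p r / (r ^ 2 * ψ r)) atTop (𝓝 (1 / 2)) := by
    refine tendsto_div_of_tendsto_deriv_div h.ev_p hg hgt hgpos ?_
    refine (tendsto_const_nhds.div hden two_ne_zero).congr' ?_
    filter_upwards [eventually_gt_atTop 0, hψpos] with r hr h1
    have := h.q_pos hr
    simp only [Pi.div_apply]
    field_simp
  have hφψ : Tendsto (fun r => φ r / (r ^ 2 * ψ r)) atTop (𝓝 (1 / 2 / 2)) := by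
    refine tendsto_div_of_tendsto_deriv_div h.ev_φ hg hgt hgpos ?_
    refine (hp.div hden two_ne_zero).congr' ?_
    filter_upwards [eventually_gt_atTop 0, hψpos] with r hr h1
    have := h.q_pos hr
    simp only [Pi.div_apply]
    field_simp
  have hψq : Tendsto (fun r => ψ r / (Real.log r * q r)) atTop (𝓝 1) := by
    refine tendsto_div_of_tendsto_deriv_div (g' := fun r => r⁻¹ * q r + Real.log r * (r * φ r ^ (-1 : ℝ)))
      h.ev_ψ ?_ (Real.tendsto_log_atTop.atTop_mul_atTop₀ hqt) ?_ ?_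
    · filter_upwards [eventually_gt_atTop 0] with r hr
      exact (Real.hasDerivAt_log (ne_of_gt hr)).mul (h.deriv_q r hr)
    · filter_upwards [eventually_gt_atTop 1] with r hr
      have := Real.log_pos hr
      have := Real.rpow_pos_of_pos (h.pos r) (-1)
      have := h.q_pos (zero_lt_one.trans hr)
      positivity
    · have h1 : Tendsto (fun r => 1 + r ^ 2 * Real.log r / (φ r * q r)) atTop (𝓝 1) := by
        simpa using hden0.const_add 1
      have := h1.inv₀ one_ne_zero
      rw [inv_one] at this
      refine this.congr' ?_
      filter_upwards [eventually_gt_atTop 1] with r hr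
      have := Real.log_pos hr
      have := h.pos r
      have := h.q_pos (zero_lt_one.trans hr)
      rw [Real.rpow_neg_one]
      field_simp
  have hq2 : Tendsto (fun r => q r ^ 2 / Real.log (Real.log r)) atTop (𝓝 8) := by
    refine tendsto_div_of_tendsto_deriv_div (f' := fun r => 2 * q r * (r * φ r ^ (-1 : ℝ)))
      ?_ ((eventually_gt_atTop 1).mono fun r hr => hasDerivAt_log_log hr) tendsto_log_log ?_ ?_
    · filter_upwards [eventually_gt_atTop 0] with r hr
      exact ((h.deriv_q r hr).pow 2).congr_deriv (by norm_num)
    · filter_upwards [eventually_gt_atTop 1] with r hr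
      have := Real.log_pos hr
      positivity
    · -- The quotient of derivatives is `2 (r² ψ / φ) (q log r / ψ)`, with limit `2 * 4 * 1`.
      have h1 := ((hφψ.inv₀ (by norm_num)).mul (hψq.inv₀ one_ne_zero)).const_mul 2
      have h2 : 2 * (((1 : ℝ) / 2 / 2)⁻¹ * 1⁻¹) = 8 := by norm_num
      rw [h2] at h1
      refine h1.congr' ?_
      filter_upwards [eventually_gt_atTop 1, hψpos] with r hr hψr
      have := Real.log_pos hr
      have := h.pos r
      have := h.q_pos (zero_lt_one.trans hr)
      rw [Real.rpow_neg_one]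
      field_simp
  have hq1 : Tendsto (fun r => q r / Real.log (Real.log r) ^ ((1 : ℝ) / 2)) atTop (𝓝 √8) := by
    refine ((Real.continuous_sqrt.tendsto _).comp hq2).congr' ?_
    filter_upwards [eventually_gt_atTop 1, tendsto_log_log.eventually_gt_atTop 0] with r hr hl
    have := h.q_pos (zero_lt_one.trans hr)
    simp only [Function.comp]
    rw [Real.sqrt_div (by positivity), Real.sqrt_sq this.le, Real.sqrt_eq_rpow]
  have hfin := ((hφψ.mul hψq).mul hq1).div_const ((2 : ℝ) ^ (-(1 : ℝ) / 2))
  have hconst : (1 : ℝ) / 2 / 2 * 1 * √8 / (2 : ℝ) ^ (-(1 : ℝ) / 2) = 1 := by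
    have h8 : √(8 : ℝ) = 2 * √2 := by
      rw [show (8 : ℝ) = 2 ^ 2 * 2 by norm_num, Real.sqrt_mul (by positivity),
        Real.sqrt_sq (by norm_num)]
    have h2 : (2 : ℝ) ^ (-(1 : ℝ) / 2) = (√2)⁻¹ := by
      rw [Real.sqrt_eq_rpow, ← Real.rpow_neg (by norm_num)]
      norm_num
    have hs : √(2 : ℝ) * √2 = 2 := Real.mul_self_sqrt (by norm_num)
    rw [h8, h2, div_inv_eq_mul]
    nlinarith
  rw [hconst] at hfin
  refine hfin.congr' ?_
  filter_upwards [eventually_gt_atTop 1, hψpos, tendsto_log_log.eventually_gt_atTop 0]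
    with r hr hψr hl
  have := Real.log_pos hr
  have := h.pos r
  have := h.q_pos (zero_lt_one.trans hr)
  have := Real.rpow_pos_of_pos hl (1 / 2)
  have : (0 : ℝ) < 2 ^ (-(1 : ℝ) / 2) := by positivity
  field_simp

end RadialSystem

/-! ### Comparison for the linear radial problem -/

/-- The linear problem `Δ² φ = s` for radial functions in the plane, as a first order system on
`r > 0` with `ψ = Δ φ`, `p = r φ'` and `q = r ψ'`. -/
structure RadialBilaplacian (φ ψ p q s : ℝ → ℝ) : Prop where
  deriv_φ : ∀ r, 0 < r → HasDerivAt φ (p r / r) r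
  deriv_p : ∀ r, 0 < r → HasDerivAt p (r * ψ r) r
  deriv_ψ : ∀ r, 0 < r → HasDerivAt ψ (q r / r) r
  deriv_q : ∀ r, 0 < r → HasDerivAt q (r * s r) r

lemma RadialSystem.radialBilaplacian {α : ℝ} {φ ψ p q : ℝ → ℝ} (h : RadialSystem α φ ψ p q) :
    RadialBilaplacian φ ψ p q fun r => φ r ^ α :=
  ⟨h.deriv_φ, h.deriv_p, h.deriv_ψ, h.deriv_q⟩

lemma radialBilaplacian_rpow (N β : ℝ) :
    RadialBilaplacian (fun r => N * r ^ β) (fun r => N * β ^ 2 * r ^ (β - 2))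
      (fun r => N * β * r ^ β) (fun r => N * β ^ 2 * (β - 2) * r ^ (β - 2))
      (fun r => N * (β ^ 2 * (β - 2) ^ 2) * r ^ (β - 4)) := by
  have h2 : ∀ r : ℝ, 0 < r → r ^ β = r ^ (β - 4) * r ^ 4 := fun r hr => by
    rw [← Real.rpow_natCast, ← Real.rpow_add hr]; norm_num
  have h3 : ∀ r : ℝ, 0 < r → r ^ (β - 2) = r ^ (β - 4) * r ^ 2 := fun r hr => by
    rw [← Real.rpow_natCast, ← Real.rpow_add hr]; congr 1; push_cast; ring
  have hd : ∀ c γ r : ℝ, 0 < r → HasDerivAt (fun r : ℝ => c * r ^ γ) (c * γ * r ^ γ / r) r :=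
    fun c γ r hr => by
      refine ((Real.hasDerivAt_rpow_const (Or.inl hr.ne')).const_mul c).congr_deriv ?_
      rw [Real.rpow_sub_one hr.ne']
      ring
  refine ⟨fun r hr => (hd _ _ r hr), fun r hr => (hd _ _ r hr).congr_deriv ?_,
    fun r hr => (hd _ _ r hr), fun r hr => (hd _ _ r hr).congr_deriv ?_⟩
  · simp only [h2 r hr, h3 r hr]
    field_simp
  · simp only [h3 r hr]
    field_simp

namespace RadialBilaplacian

variable {φ₁ ψ₁ p₁ q₁ s₁ φ₂ ψ₂ p₂ q₂ s₂ : ℝ → ℝ}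

lemma le_of_le (h₁ : RadialBilaplacian φ₁ ψ₁ p₁ q₁ s₁) (h₂ : RadialBilaplacian φ₂ ψ₂ p₂ q₂ s₂)
    {a b : ℝ} (ha : 0 < a) (hab : a ≤ b) (hφ : φ₁ a ≤ φ₂ a) (hψ : ψ₁ a ≤ ψ₂ a)
    (hp : p₁ a ≤ p₂ a) (hq : q₁ a ≤ q₂ a) (hs : ∀ x ∈ Set.Icc a b, s₁ x ≤ s₂ x) :
    φ₁ b ≤ φ₂ b := by
  have key : ∀ {f g f' g' : ℝ → ℝ}, (∀ x, 0 < x → HasDerivAt f (f' x) x) →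
      (∀ x, 0 < x → HasDerivAt g (g' x) x) → f a ≤ g a →
      (∀ x ∈ Set.Icc a b, f' x ≤ g' x) → ∀ x ∈ Set.Icc a b, f x ≤ g x := by
    intro f g f' g' hf hg hfg hle x hx
    have := sub_le_sub_of_hasDerivAt_le hx.1
      (fun y hy => (hf y (ha.trans_le hy.1)).continuousAt.continuousWithinAt)
      (fun y hy => (hg y (ha.trans_le hy.1)).continuousAt.continuousWithinAt)
      (fun y hy => hf y (ha.trans hy.1)) (fun y hy => hg y (ha.trans hy.1))
      (fun y hy => hle y ⟨hy.1.le, hy.2.le.trans hx.2⟩)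
    linarith
  have hq' := key h₁.deriv_q h₂.deriv_q hq fun x hx =>
    mul_le_mul_of_nonneg_left (hs x hx) (ha.le.trans hx.1)
  have hψ' := key h₁.deriv_ψ h₂.deriv_ψ hψ fun x hx =>
    div_le_div_of_nonneg_right (hq' x hx) (ha.le.trans hx.1)
  have hp' := key h₁.deriv_p h₂.deriv_p hp fun x hx =>
    mul_le_mul_of_nonneg_left (hψ' x hx) (ha.le.trans hx.1)
  exact key h₁.deriv_φ h₂.deriv_φ hφ (fun x hx =>
    div_le_div_of_nonneg_right (hp' x hx) (ha.le.trans hx.1)) b ⟨hab, le_rfl⟩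

lemma eventually_le_mul (h₁ : RadialBilaplacian φ₁ ψ₁ p₁ q₁ s₁)
    (h₂ : RadialBilaplacian φ₂ ψ₂ p₂ q₂ s₂) (hφ : Tendsto φ₂ atTop atTop)
    (hψ : Tendsto ψ₂ atTop atTop) (hp : Tendsto p₂ atTop atTop) (hq : Tendsto q₂ atTop atTop)
    {c d : ℝ} (hcd : c < d) (hs : ∀ᶠ r in atTop, s₁ r ≤ c * s₂ r) :
    ∀ᶠ r in atTop, φ₁ r ≤ d * φ₂ r := by
  obtain ⟨c₁, h1, h1d⟩ := exists_between hcd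
  obtain ⟨c₂, h2, h2d⟩ := exists_between h1d
  obtain ⟨c₃, h3, h3d⟩ := exists_between h2d
  have pos := eventually_gt_atTop (0 : ℝ)
  have hq' := eventually_le_mul_of_deriv_le h1 (pos.mono h₁.deriv_q) (pos.mono h₂.deriv_q) hq (by
    filter_upwards [pos, hs] with r hr hr'
    calc r * s₁ r ≤ r * (c * s₂ r) := mul_le_mul_of_nonneg_left hr' hr.le
      _ = c * (r * s₂ r) := by ring)
  have hψ' := eventually_le_mul_of_deriv_le h2 (pos.mono h₁.deriv_ψ) (pos.mono h₂.deriv_ψ) hψ (by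
    filter_upwards [pos, hq'] with r hr hr'
    rw [← mul_div_assoc]
    exact div_le_div_of_nonneg_right hr' hr.le)
  have hp' := eventually_le_mul_of_deriv_le h3 (pos.mono h₁.deriv_p) (pos.mono h₂.deriv_p) hp (by
    filter_upwards [pos, hψ'] with r hr hr'
    calc r * ψ₁ r ≤ r * (c₂ * ψ₂ r) := mul_le_mul_of_nonneg_left hr' hr.le
      _ = c₂ * (r * ψ₂ r) := by ring)
  exact eventually_le_mul_of_deriv_le h3d (pos.mono h₁.deriv_φ) (pos.mono h₂.deriv_φ) hφ (by
    filter_upwards [pos, hp'] with r hr hr'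
    rw [← mul_div_assoc]
    exact div_le_div_of_nonneg_right hr' hr.le)

lemma neg (h : RadialBilaplacian φ₁ ψ₁ p₁ q₁ s₁) :
    RadialBilaplacian (-φ₁) (-ψ₁) (-p₁) (-q₁) (-s₁) :=
  ⟨fun r hr => (h.deriv_φ r hr).neg.congr_deriv (by simp [neg_div]),
    fun r hr => (h.deriv_p r hr).neg.congr_deriv (by simp),
    fun r hr => (h.deriv_ψ r hr).neg.congr_deriv (by simp [neg_div]),
    fun r hr => (h.deriv_q r hr).neg.congr_deriv (by simp)⟩

lemma eventually_mul_le (h₁ : RadialBilaplacian φ₁ ψ₁ p₁ q₁ s₁)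
    (h₂ : RadialBilaplacian φ₂ ψ₂ p₂ q₂ s₂) (hφ : Tendsto φ₂ atTop atTop)
    (hψ : Tendsto ψ₂ atTop atTop) (hp : Tendsto p₂ atTop atTop) (hq : Tendsto q₂ atTop atTop)
    {c d : ℝ} (hdc : d < c) (hs : ∀ᶠ r in atTop, c * s₂ r ≤ s₁ r) :
    ∀ᶠ r in atTop, d * φ₂ r ≤ φ₁ r := by
  have := h₁.neg.eventually_le_mul h₂ hφ hψ hp hq (neg_lt_neg hdc) (hs.mono fun r hr => by
    simp only [Pi.neg_apply]; linarith)
  refine this.mono fun r hr => ?_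
  simp only [Pi.neg_apply] at hr
  linarith

end RadialBilaplacian

/-! ### Power growth: exponents between `-1` and `1` -/

lemma abs_log_le_iff {x h : ℝ} (hx : 0 < x) :
    |Real.log x| ≤ h ↔ Real.exp (-h) ≤ x ∧ x ≤ Real.exp h := by
  rw [abs_le, Real.le_log_iff_exp_le hx, Real.log_le_iff_le_exp hx]

/-- Raising to the power `α` contracts the logarithmic distance to `y` by the factor `|α|`. -/
lemma rpow_mem_of_mem_exp {α x y h : ℝ} (hx : 0 < x) (hy : 0 < y)
    (h1 : Real.exp (-h) * y ≤ x) (h2 : x ≤ Real.exp h * y) :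
    Real.exp (-(|α| * h)) * y ^ α ≤ x ^ α ∧ x ^ α ≤ Real.exp (|α| * h) * y ^ α := by
  have hxy : |Real.log (x / y)| ≤ h :=
    (abs_log_le_iff (div_pos hx hy)).2 ⟨(le_div_iff₀ hy).2 h1, (div_le_iff₀ hy).2 h2⟩
  have hyα := Real.rpow_pos_of_pos hy α
  have hp : 0 < (x / y) ^ α := Real.rpow_pos_of_pos (div_pos hx hy) α
  have h3 : |Real.log ((x / y) ^ α)| ≤ |α| * h := by
    rw [Real.log_rpow (div_pos hx hy), abs_mul]
    exact mul_le_mul_of_nonneg_left hxy (abs_nonneg _)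
  rw [abs_log_le_iff hp, Real.div_rpow hx.le hy.le, le_div_iff₀ hyα, div_le_iff₀ hyα] at h3
  exact h3

namespace RadialSystem

variable {α β L : ℝ} {φ ψ p q : ℝ → ℝ}

/-- If `L r ^ β` solves the equation, then a bound `|log (φ / (L r ^ β))| ≤ h` controls the right
hand side `φ ^ α` within the factor `exp (|α| h)`. -/
lemma source_bounds (h : RadialSystem α φ ψ p q) (hL : 0 < L) (hβ : α * β = β - 4)
    (hLα : L ^ α = L * (β ^ 2 * (β - 2) ^ 2)) {k r : ℝ} (hr : 0 < r)
    (h1 : Real.exp (-k) * (L * r ^ β) ≤ φ r) (h2 : φ r ≤ Real.exp k * (L * r ^ β)) :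
    Real.exp (-(|α| * k)) * (L * (β ^ 2 * (β - 2) ^ 2) * r ^ (β - 4)) ≤ φ r ^ α ∧
      φ r ^ α ≤ Real.exp (|α| * k) * (L * (β ^ 2 * (β - 2) ^ 2) * r ^ (β - 4)) := by
  have hrβ := Real.rpow_pos_of_pos hr β
  have h3 := rpow_mem_of_mem_exp (α := α) (h.pos r) (mul_pos hL hrβ) h1 h2
  rwa [Real.mul_rpow hL.le hrβ.le, ← Real.rpow_mul hr.le, mul_comm β α, hβ, hLα] at h3

/-- Comparison on `[a, b]` with the multiples `exp (± m) L r ^ β` of the power solution, where `m`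
is large enough for the initial data at `a` and for the source term. -/
lemma bounds_step (h : RadialSystem α φ ψ p q) (hL : 0 < L) (hβ2 : 2 < β)
    (hβ : α * β = β - 4) (hLα : L ^ α = L * (β ^ 2 * (β - 2) ^ 2)) {a b k m : ℝ} (ha : 0 < a)
    (hab : a ≤ b) (hkm : |α| * k ≤ m)
    (hφ : Real.exp (-m) * (L * a ^ β) ≤ φ a ∧ φ a ≤ Real.exp m * (L * a ^ β))
    (hψ : Real.exp (-m) * (L * β ^ 2 * a ^ (β - 2)) ≤ ψ a ∧
      ψ a ≤ Real.exp m * (L * β ^ 2 * a ^ (β - 2)))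
    (hp : Real.exp (-m) * (L * β * a ^ β) ≤ p a ∧ p a ≤ Real.exp m * (L * β * a ^ β))
    (hq : Real.exp (-m) * (L * β ^ 2 * (β - 2) * a ^ (β - 2)) ≤ q a ∧
      q a ≤ Real.exp m * (L * β ^ 2 * (β - 2) * a ^ (β - 2)))
    (hb : ∀ x ∈ Set.Icc a b, Real.exp (-k) * (L * x ^ β) ≤ φ x ∧
      φ x ≤ Real.exp k * (L * x ^ β)) :
    Real.exp (-m) * (L * b ^ β) ≤ φ b ∧ φ b ≤ Real.exp m * (L * b ^ β) := by
  have hs : ∀ x ∈ Set.Icc a b, 0 ≤ L * (β ^ 2 * (β - 2) ^ 2) * x ^ (β - 4) := fun x hx => by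
    have : 0 < x := ha.trans_le hx.1
    positivity
  have hsrc := fun x (hx : x ∈ Set.Icc a b) =>
    h.source_bounds hL hβ hLα (ha.trans_le hx.1) (hb x hx).1 (hb x hx).2
  constructor
  · have := (radialBilaplacian_rpow (Real.exp (-m) * L) β).le_of_le h.radialBilaplacian ha hab
      (by simpa only [mul_assoc] using hφ.1) (by simpa only [mul_assoc] using hψ.1)
      (by simpa only [mul_assoc] using hp.1) (by simpa only [mul_assoc] using hq.1)
      (fun x hx => le_trans (by
        have := mul_le_mul_of_nonneg_right
          (Real.exp_le_exp.2 (neg_le_neg hkm)) (hs x hx)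
        simpa only [mul_assoc] using this) (hsrc x hx).1)
    simpa only [mul_assoc] using this
  · have := h.radialBilaplacian.le_of_le (radialBilaplacian_rpow (Real.exp m * L) β) ha hab
      (by simpa only [mul_assoc] using hφ.2) (by simpa only [mul_assoc] using hψ.2)
      (by simpa only [mul_assoc] using hp.2) (by simpa only [mul_assoc] using hq.2)
      (fun x hx => le_trans (hsrc x hx).2 (by
        have := mul_le_mul_of_nonneg_right (Real.exp_le_exp.2 hkm) (hs x hx)
        simpa only [mul_assoc] using this))
    simpa only [mul_assoc] using this

lemma eventually_exp_mul_bounds {X Y : ℝ} (hX : 0 < X) (hY : 0 < Y) :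
    ∀ᶠ m in atTop, Real.exp (-m) * Y ≤ X ∧ X ≤ Real.exp m * Y := by
  filter_upwards [eventually_ge_atTop |Real.log (X / Y)|] with m hm
  have := (abs_log_le_iff (div_pos hX hY)).1 hm
  rwa [le_div_iff₀ hY, div_le_iff₀ hY] at this

/-- The logarithmic distance of `φ` to the power solution is bounded: at a maximum point of it
on a compact interval, comparison with multiples of the power solution would give `k ≤ |α| k`. -/
lemma exists_eventually_bounds (h : RadialSystem α φ ψ p q) (hα : |α| < 1) (hL : 0 < L)
    (hβ2 : 2 < β) (hβ : α * β = β - 4) (hLα : L ^ α = L * (β ^ 2 * (β - 2) ^ 2)) :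
    ∃ m > 0, ∀ᶠ r in atTop,
      Real.exp (-m) * (L * r ^ β) ≤ φ r ∧ φ r ≤ Real.exp m * (L * r ^ β) := by
  have hp : ∀ᶠ r in atTop, 0 < p r := by
    obtain ⟨c, hc, hle⟩ := h.exists_sq_mul_log_le_p
    filter_upwards [hle, eventually_gt_atTop 1] with r h1 h2
    have := Real.log_pos h2
    exact lt_of_lt_of_le (by positivity) h1
  obtain ⟨a, ha0, hpa, hψa⟩ := ((eventually_gt_atTop (0 : ℝ)).and
    (hp.and (h.tendsto_ψ.eventually_gt_atTop 0))).exists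
  have hβ3 : 0 < β - 2 := by linarith
  have hβ0 : 0 < β := by linarith
  obtain ⟨m, hm0, hmφ, hmψ, hmp, hmq⟩ := ((eventually_gt_atTop (0 : ℝ)).and
    ((eventually_exp_mul_bounds (h.pos a) (show 0 < L * a ^ β by positivity)).and
    ((eventually_exp_mul_bounds hψa (show 0 < L * β ^ 2 * a ^ (β - 2) by positivity)).and
    ((eventually_exp_mul_bounds hpa (show 0 < L * β * a ^ β by positivity)).and
    (eventually_exp_mul_bounds (h.q_pos ha0)
      (show 0 < L * β ^ 2 * (β - 2) * a ^ (β - 2) by positivity)))))).exists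
  have hmono : ∀ {X Y m' : ℝ}, 0 < Y → m ≤ m' →
      Real.exp (-m) * Y ≤ X ∧ X ≤ Real.exp m * Y →
      Real.exp (-m') * Y ≤ X ∧ X ≤ Real.exp m' * Y := fun {X Y m'} hY hm' hXY =>
    ⟨(mul_le_mul_of_nonneg_right (Real.exp_le_exp.2 (neg_le_neg hm')) hY.le).trans hXY.1,
      hXY.2.trans (mul_le_mul_of_nonneg_right (Real.exp_le_exp.2 hm') hY.le)⟩
  have hiff : ∀ x, 0 < x → ∀ k, (Real.exp (-k) * (L * x ^ β) ≤ φ x ∧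
      φ x ≤ Real.exp k * (L * x ^ β) ↔ |Real.log (φ x / (L * x ^ β))| ≤ k) := fun x hx k => by
    have hY : 0 < L * x ^ β := by positivity
    rw [abs_log_le_iff (div_pos (h.pos x) hY), le_div_iff₀ hY, div_le_iff₀ hY]
  refine ⟨m, hm0, ?_⟩
  filter_upwards [eventually_ge_atTop a] with R hR
  have hcont : ContinuousOn (fun x => |Real.log (φ x / (L * x ^ β))|) (Set.Icc a R) := by
    refine ContinuousOn.abs (ContinuousOn.log (h.cont_φ.continuousOn.div ?_ ?_) ?_)
    · exact continuousOn_const.mul (continuousOn_id.rpow_const fun x hx =>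
        Or.inl (ha0.trans_le hx.1).ne')
    · intro x hx
      have : 0 < x := ha0.trans_le hx.1
      positivity
    · intro x hx
      have : 0 < x := ha0.trans_le hx.1
      have := h.pos x
      positivity
  obtain ⟨z, hz, hzmax⟩ := isCompact_Icc.exists_isMaxOn ⟨a, le_rfl, hR⟩ hcont
  have hz0 : 0 < z := ha0.trans_le hz.1
  set k := |Real.log (φ z / (L * z ^ β))| with hk
  have hmem : ∀ x ∈ Set.Icc a R, Real.exp (-k) * (L * x ^ β) ≤ φ x ∧
      φ x ≤ Real.exp k * (L * x ^ β) := fun x hx =>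
    (hiff x (ha0.trans_le hx.1) k).2 (hzmax hx)
  have hm' : m ≤ max m (|α| * k) := le_max_left _ _
  have hstep := h.bounds_step hL hβ2 hβ hLα ha0 hz.1 (le_max_right m (|α| * k))
    (hmono (by positivity) hm' hmφ) (hmono (by positivity) hm' hmψ)
    (hmono (by positivity) hm' hmp) (hmono (by positivity) hm' hmq)
    (fun x hx => hmem x ⟨hx.1, hx.2.trans hz.2⟩)
  rw [hiff z hz0, ← hk] at hstep
  have hkm : k ≤ m := by
    by_contra! hlt
    rcases le_max_iff.1 hstep with h1 | h1
    · linarith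
    · nlinarith [abs_nonneg α]
  exact (hiff R (ha0.trans_le hR) m).2 ((hzmax ⟨hR, le_rfl⟩ : _ ≤ k).trans hkm)

/-- Near infinity the initial data no longer matter: a bound `k` on the logarithmic distance to the
power solution improves to any bound larger than `|α| k`. -/
lemma eventually_bounds_step (h : RadialSystem α φ ψ p q) (hL : 0 < L)
    (hβ2 : 2 < β) (hβ : α * β = β - 4) (hLα : L ^ α = L * (β ^ 2 * (β - 2) ^ 2)) {k m : ℝ}
    (hkm : |α| * k < m)
    (hk : ∀ᶠ r in atTop, Real.exp (-k) * (L * r ^ β) ≤ φ r ∧ φ r ≤ Real.exp k * (L * r ^ β)) :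
    ∀ᶠ r in atTop, Real.exp (-m) * (L * r ^ β) ≤ φ r ∧ φ r ≤ Real.exp m * (L * r ^ β) := by
  have hβ3 : 0 < β - 2 := by linarith
  have hβ0 : 0 < β := by linarith
  have hpow := radialBilaplacian_rpow L β
  have t1 := tendsto_rpow_atTop hβ0
  have t2 := tendsto_rpow_atTop hβ3
  have tφ := t1.const_mul_atTop hL
  have tψ := t2.const_mul_atTop (show 0 < L * β ^ 2 by positivity)
  have tp := t1.const_mul_atTop (show 0 < L * β by positivity)
  have tq := t2.const_mul_atTop (show 0 < L * β ^ 2 * (β - 2) by positivity)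
  have hsrc : ∀ᶠ r in atTop, _ := hk.mp ((eventually_gt_atTop 0).mono fun r hr hkr =>
    h.source_bounds hL hβ hLα hr hkr.1 hkr.2)
  exact (h.radialBilaplacian.eventually_mul_le hpow tφ tψ tp tq
      (Real.exp_lt_exp.2 (neg_lt_neg hkm)) (hsrc.mono fun r hr => hr.1)).and
    (h.radialBilaplacian.eventually_le_mul hpow tφ tψ tp tq
      (Real.exp_lt_exp.2 hkm) (hsrc.mono fun r hr => hr.2))

lemma tendsto_div_rpow (h : RadialSystem α φ ψ p q) (hα : |α| < 1) (hL : 0 < L)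
    (hβ2 : 2 < β) (hβ : α * β = β - 4) (hLα : L ^ α = L * (β ^ 2 * (β - 2) ^ 2)) :
    Tendsto (fun r => φ r / (L * r ^ β)) atTop (𝓝 1) := by
  obtain ⟨m, hm0, hm⟩ := h.exists_eventually_bounds hα hL hβ2 hβ hLα
  -- Each step contracts by any factor larger than `|α|`; `θ` leaves room below `1`.
  set θ := (1 + |α|) / 2 with hθ
  have hα0 := abs_nonneg α
  have hθ0 : 0 < θ := by positivity
  have hθ1 : θ < 1 := by linarith
  have hiter : ∀ n : ℕ, ∀ᶠ r in atTop, Real.exp (-(θ ^ n * m)) * (L * r ^ β) ≤ φ r ∧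
      φ r ≤ Real.exp (θ ^ n * m) * (L * r ^ β) := by
    intro n
    induction n with
    | zero => simpa using hm
    | succ n ih =>
      refine h.eventually_bounds_step hL hβ2 hβ hLα ?_ ih
      rw [pow_succ', mul_assoc]
      exact mul_lt_mul_of_pos_right (by linarith) (by positivity)
  have hlog : Tendsto (fun r => Real.log (φ r / (L * r ^ β))) atTop (𝓝 0) := by
    rw [Metric.tendsto_nhds]
    intro ε hε
    have hlim : Tendsto (fun n : ℕ => θ ^ n * m) atTop (𝓝 0) := by
      simpa using (tendsto_pow_atTop_nhds_zero_of_lt_one hθ0.le hθ1).mul_const m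
    obtain ⟨n, hn⟩ := (hlim.eventually_lt_const hε).exists
    filter_upwards [hiter n, eventually_gt_atTop 0] with r hr hr0
    have hY : 0 < L * r ^ β := by positivity
    rw [Real.dist_eq, sub_zero]
    refine lt_of_le_of_lt ((abs_log_le_iff (div_pos (h.pos r) hY)).2 ?_) hn
    rwa [le_div_iff₀ hY, div_le_iff₀ hY]
  have hexp := (Real.continuous_exp.tendsto 0).comp hlog
  rw [Real.exp_zero] at hexp
  refine hexp.congr' ?_
  filter_upwards [eventually_gt_atTop 0] with r hr0
  exact Real.exp_log (div_pos (h.pos r) (by positivity))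

theorem asymp_of_abs_lt_one (h : RadialSystem α φ ψ p q) (h1 : -1 < α) (h2 : α < 1) :
    AsympAtInfty φ fun r =>
      ((2 + 4 * α / (1 - α)) * (2 + 4 * α / (1 - α) + 2)
            * (4 * α / (1 - α) + 2) * (4 * α / (1 - α) + 4)) ^ (-1 / (1 - α))
          * r ^ (4 / (1 - α)) := by
  have h3 : 0 < 1 - α := by linarith
  set β := 4 / (1 - α) with hβdef
  have hβ : α * β = β - 4 := by rw [hβdef]; field_simp; ring
  have hβ2 : 2 < β := by rw [hβdef, lt_div_iff₀ h3]; linarith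
  have h4 : 4 * α / (1 - α) = β - 4 := by rw [← hβ, hβdef]; ring
  have hA : (2 + 4 * α / (1 - α)) * (2 + 4 * α / (1 - α) + 2)
      * (4 * α / (1 - α) + 2) * (4 * α / (1 - α) + 4) = β ^ 2 * (β - 2) ^ 2 := by
    rw [h4]; ring
  rw [hA]
  have hA0 : 0 < β ^ 2 * (β - 2) ^ 2 := by
    have : 0 < β - 2 := by linarith
    positivity
  refine h.tendsto_div_rpow (abs_lt.2 ⟨h1, h2⟩) (Real.rpow_pos_of_pos hA0 _) hβ2 hβ ?_
  rw [← Real.rpow_mul hA0.le, ← Real.rpow_add_one hA0.ne']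
  congr 1
  field_simp
  ring

end RadialSystem

/-! ### The modified Bessel function of order zero -/

/-- The integral `∫₀^π exp (r cos θ) dθ`, which is `π I₀(r)` for the modified Bessel function
`I₀`. -/
noncomputable def besselIntegral (r : ℝ) : ℝ :=
  ∫ θ in (0 : ℝ)..Real.pi, Real.exp (r * Real.cos θ)

/-- The integral `∫₀^π cos θ exp (r cos θ) dθ`, the derivative of `besselIntegral`. -/
noncomputable def besselIntegralDeriv (r : ℝ) : ℝ :=
  ∫ θ in (0 : ℝ)..Real.pi, Real.cos θ * Real.exp (r * Real.cos θ)

lemma hasDerivAt_integral_mul_exp_cos {g : ℝ → ℝ} (hg : Continuous g) (hg1 : ∀ θ, |g θ| ≤ 1)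
    (r : ℝ) :
    HasDerivAt (fun r => ∫ θ in (0 : ℝ)..Real.pi, g θ * Real.exp (r * Real.cos θ))
      (∫ θ in (0 : ℝ)..Real.pi, g θ * (Real.cos θ * Real.exp (r * Real.cos θ))) r := by
  refine (intervalIntegral.hasDerivAt_integral_of_dominated_loc_of_deriv_le
    (F' := fun r θ => g θ * (Real.cos θ * Real.exp (r * Real.cos θ)))
    (bound := fun _ => Real.exp (|r| + 1)) (Metric.ball_mem_nhds r one_pos) ?_ ?_ ?_ ?_ ?_ ?_).2
  · exact Eventually.of_forall fun x =>
      (by fun_prop : Continuous fun θ => g θ * Real.exp (x * Real.cos θ)).aestronglyMeasurable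
  · exact (by fun_prop : Continuous fun θ => g θ * Real.exp (r * Real.cos θ)).intervalIntegrable _ _
  · exact (by fun_prop : Continuous fun θ =>
      g θ * (Real.cos θ * Real.exp (r * Real.cos θ))).aestronglyMeasurable
  · refine Eventually.of_forall fun θ _ x hx => ?_
    have h1 : |x| ≤ |r| + 1 := by
      have := abs_sub_abs_le_abs_sub x r
      rw [Metric.mem_ball, Real.dist_eq] at hx
      linarith
    have h2 : x * Real.cos θ ≤ |r| + 1 := by
      refine (le_abs_self _).trans ?_
      rw [abs_mul]
      exact (mul_le_of_le_one_right (abs_nonneg x) (Real.abs_cos_le_one θ)).trans h1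
    rw [Real.norm_eq_abs, abs_mul, abs_mul, Real.abs_exp]
    calc |g θ| * (|Real.cos θ| * Real.exp (x * Real.cos θ))
        ≤ 1 * (1 * Real.exp (|r| + 1)) := by
          gcongr
          · exact hg1 θ
          · exact Real.abs_cos_le_one θ
      _ = _ := by ring
  · exact continuous_const.intervalIntegrable _ _
  · refine Eventually.of_forall fun θ _ x _ => ?_
    have := ((hasDerivAt_mul_const (x := x) (Real.cos θ)).exp).const_mul (g θ)
    exact this.congr_deriv (by ring)

lemma hasDerivAt_besselIntegral (r : ℝ) :
    HasDerivAt besselIntegral (besselIntegralDeriv r) r := by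
  have := hasDerivAt_integral_mul_exp_cos (g := fun _ => 1) continuous_const (by simp) r
  simp only [one_mul] at this
  exact this

/-- Bessel's equation `(r J')' = r J`: integration by parts turns `∫ cos θ exp (r cos θ)` into
`r ∫ sin² θ exp (r cos θ)`. -/
lemma hasDerivAt_mul_besselIntegralDeriv (r : ℝ) :
    HasDerivAt (fun r => r * besselIntegralDeriv r) (r * besselIntegral r) r := by
  have h1 := hasDerivAt_integral_mul_exp_cos Real.continuous_cos Real.abs_cos_le_one r
  refine ((hasDerivAt_id r).mul h1).congr_deriv ?_
  have h2 : ∫ θ in (0 : ℝ)..Real.pi, (Real.cos θ * Real.exp (r * Real.cos θ)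
      - Real.sin θ * (r * Real.sin θ * Real.exp (r * Real.cos θ))) = 0 := by
    rw [intervalIntegral.integral_eq_sub_of_hasDerivAt
      (f := fun θ => Real.sin θ * Real.exp (r * Real.cos θ)) ?_ ?_]
    · simp
    · intro θ _
      refine ((Real.hasDerivAt_sin θ).mul ((Real.hasDerivAt_cos θ).const_mul r).exp).congr_deriv ?_
      ring
    · exact (by fun_prop : Continuous fun θ => (Real.cos θ * Real.exp (r * Real.cos θ)
        - Real.sin θ * (r * Real.sin θ * Real.exp (r * Real.cos θ)))).intervalIntegrable _ _
  have hint : ∀ f : ℝ → ℝ, Continuous f →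
      IntervalIntegrable f MeasureTheory.volume 0 Real.pi := fun f hf => hf.intervalIntegrable _ _
  simp only [id, one_mul, besselIntegral]
  rw [← intervalIntegral.integral_const_mul r, ← intervalIntegral.integral_const_mul r,
    ← intervalIntegral.integral_add (hint _ (by fun_prop)) (hint _ (by fun_prop)),
    ← sub_eq_zero, ← intervalIntegral.integral_sub (hint _ (by fun_prop)) (hint _ (by fun_prop))]
  refine Eq.trans (intervalIntegral.integral_congr fun θ _ => ?_) h2
  have := Real.sin_sq_add_cos_sq θ
  linear_combination r * Real.exp (r * Real.cos θ) * this

lemma besselIntegral_pos (r : ℝ) : 0 < besselIntegral r :=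
  intervalIntegral.intervalIntegral_pos_of_pos
    ((by fun_prop : Continuous fun θ => Real.exp (r * Real.cos θ)).intervalIntegrable _ _)
    (fun _ => Real.exp_pos _) Real.pi_pos

lemma besselIntegral_zero : besselIntegral 0 = Real.pi := by simp [besselIntegral]

lemma tendsto_mul_one_sub_cos_div_sqrt (x : ℝ) :
    Tendsto (fun r : ℝ => r * (1 - Real.cos (x / √r))) atTop (𝓝 (x ^ 2 / 2)) := by
  rw [tendsto_iff_dist_tendsto_zero]
  refine squeeze_zero' (g := fun r : ℝ => |x| ^ 4 * (5 / 96) * r⁻¹)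
    (Eventually.of_forall fun r => dist_nonneg) ?_ (by
      simpa only [mul_zero] using
        (tendsto_inv_atTop_zero (𝕜 := ℝ)).const_mul (|x| ^ 4 * (5 / 96)))
  filter_upwards [eventually_gt_atTop 0, eventually_ge_atTop (x ^ 2)] with r hr hxr
  have hs : 0 < √r := Real.sqrt_pos.2 hr
  have hss : √r ^ 2 = r := Real.sq_sqrt hr.le
  have h1 : |x / √r| ≤ 1 := by
    rw [abs_div, abs_of_pos hs, div_le_one hs]
    exact Real.abs_le_sqrt hxr
  have h2 := Real.cos_bound h1
  have h3 : r * (1 - Real.cos (x / √r)) - x ^ 2 / 2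
      = -(r * (Real.cos (x / √r) - (1 - (x / √r) ^ 2 / 2))) := by
    rw [div_pow, hss]; field_simp; ring
  rw [Real.dist_eq, h3, abs_neg, abs_mul, abs_of_pos hr]
  calc r * |Real.cos (x / √r) - (1 - (x / √r) ^ 2 / 2)|
      ≤ r * (|x / √r| ^ 4 * (5 / 96)) := mul_le_mul_of_nonneg_left h2 hr.le
    _ = |x| ^ 4 * (5 / 96) * r⁻¹ := by
      have h4 : √r ^ 4 = r ^ 2 := by rw [show √r ^ 4 = (√r ^ 2) ^ 2 by ring, hss]
      rw [abs_div, abs_of_pos hs, div_pow, h4]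
      field_simp

/-- Laplace's method: with `θ = x / √r` the integral becomes one over `0 ≤ x ≤ π √r`, dominated
by a Gaussian because `1 - cos θ ≥ 2 θ² / π²` on `[0, π]`. -/
lemma tendsto_besselIntegral :
    Tendsto (fun r => √r * Real.exp (-r) * besselIntegral r) atTop (𝓝 √(Real.pi / 2)) := by
  set F : ℝ → ℝ → ℝ := fun r => (Set.Ioc 0 (Real.pi * √r)).indicator
    fun x => Real.exp (-(r * (1 - Real.cos (x / √r)))) with hF
  have hlim : Tendsto (fun r => ∫ x in Set.Ioi (0 : ℝ), F r x) atTop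
      (𝓝 (∫ x in Set.Ioi (0 : ℝ), Real.exp (-(1 / 2) * x ^ 2))) := by
    refine MeasureTheory.tendsto_integral_filter_of_dominated_convergence
      (fun x => Real.exp (-(2 / Real.pi ^ 2) * x ^ 2)) ?_ ?_ ?_ ?_
    · refine Eventually.of_forall fun r => ?_
      refine (Measurable.indicator ?_ measurableSet_Ioc).aestronglyMeasurable
      fun_prop
    · filter_upwards [eventually_gt_atTop 0] with r hr
      refine Eventually.of_forall fun x => ?_
      by_cases hx : x ∈ Set.Ioc 0 (Real.pi * √r)
      · have hs : 0 < √r := Real.sqrt_pos.2 hr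
        have hss : √r ^ 2 = r := Real.sq_sqrt hr.le
        simp only [hF]
        rw [Set.indicator_of_mem hx, Real.norm_eq_abs, Real.abs_exp, Real.exp_le_exp]
        have h1 : |x / √r| ≤ Real.pi := by
          rw [abs_of_pos (div_pos hx.1 hs), div_le_iff₀ hs]
          exact hx.2
        have h2 := mul_le_mul_of_nonneg_left (Real.cos_le_one_sub_mul_cos_sq h1) hr.le
        have h3 : r * (1 - 2 / Real.pi ^ 2 * (x / √r) ^ 2) = r - 2 / Real.pi ^ 2 * x ^ 2 := by
          rw [div_pow, hss]; field_simp
        linarith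
      · simp only [hF]
        rw [Set.indicator_of_notMem hx, norm_zero]
        exact (Real.exp_pos _).le
    · exact (integrable_exp_neg_mul_sq (by positivity)).integrableOn
    · filter_upwards [MeasureTheory.ae_restrict_mem measurableSet_Ioi] with x hx
      have h1 := (Real.continuous_exp.tendsto _).comp (tendsto_mul_one_sub_cos_div_sqrt x).neg
      have h2 : -(x ^ 2 / 2) = -(1 / 2) * x ^ 2 := by ring
      rw [h2] at h1
      refine h1.congr' ?_
      have h3 : Tendsto (fun r => Real.pi * √r) atTop atTop :=
        Real.tendsto_sqrt_atTop.const_mul_atTop Real.pi_pos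
      filter_upwards [h3.eventually_ge_atTop x] with r hr
      simp only [hF]
      rw [Set.indicator_of_mem (show x ∈ Set.Ioc 0 (Real.pi * √r) from ⟨hx, hr⟩)]
      rfl
  rw [integral_gaussian_Ioi] at hlim
  have hconst : √(Real.pi / (1 / 2)) / 2 = √(Real.pi / 2) := by
    rw [show Real.pi / (1 / 2) = 2 ^ 2 * (Real.pi / 2) by ring, Real.sqrt_mul (by positivity),
      Real.sqrt_sq (by norm_num)]
    ring
  rw [hconst] at hlim
  refine hlim.congr' ?_
  filter_upwards [eventually_gt_atTop 0] with r hr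
  have hs : 0 < √r := Real.sqrt_pos.2 hr
  rw [hF, MeasureTheory.setIntegral_indicator measurableSet_Ioc,
    Set.inter_eq_self_of_subset_right Set.Ioc_subset_Ioi_self,
    ← intervalIntegral.integral_of_le (by positivity),
    intervalIntegral.integral_comp_div (fun θ => Real.exp (-(r * (1 - Real.cos θ)))) hs.ne',
    zero_div, mul_div_assoc, div_self hs.ne', mul_one, smul_eq_mul, mul_assoc, besselIntegral,
    ← intervalIntegral.integral_const_mul (Real.exp (-r))]
  congr 1
  refine intervalIntegral.integral_congr fun θ _ => ?_
  rw [← Real.exp_add]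
  congr 1
  ring

/-! ### The linear case: exponent `1` -/

lemma eq_of_hasDerivAt_zero {f : ℝ → ℝ} {a b : ℝ} (hab : a ≤ b)
    (hc : ContinuousOn f (Set.Icc a b)) (hf : ∀ x ∈ Set.Ioo a b, HasDerivAt f 0 x) :
    f b = f a := by
  have h1 := sub_le_sub_of_hasDerivAt_le hab hc continuousOn_const hf
    (fun x _ => hasDerivAt_const x (0 : ℝ)) (fun _ _ => le_rfl)
  have h2 := sub_le_sub_of_hasDerivAt_le hab continuousOn_const hc
    (fun x _ => hasDerivAt_const x (0 : ℝ)) hf (fun _ _ => le_rfl)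
  linarith

namespace RadialSystem

variable {φ ψ p q : ℝ → ℝ}

/-- For `α = 1`, the function `φ + ψ` solves `Δ v = v`. Its Wronskian with the Bessel function
vanishes at the origin, hence everywhere, so that the two functions are proportional. -/
lemma add_eq_mul_besselIntegral (h : RadialSystem 1 φ ψ p q) {r : ℝ} (hr : 0 ≤ r) :
    φ r + ψ r = (φ 0 + ψ 0) / Real.pi * besselIntegral r := by
  have hcJ : Continuous besselIntegral :=
    continuous_iff_continuousAt.2 fun x => (hasDerivAt_besselIntegral x).continuousAt
  have hcK : Continuous fun r => r * besselIntegralDeriv r :=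
    continuous_iff_continuousAt.2 fun x => (hasDerivAt_mul_besselIntegralDeriv x).continuousAt
  have hW : ∀ x, 0 ≤ x →
      besselIntegral x * (p x + q x) - x * besselIntegralDeriv x * (φ x + ψ x) = 0 := by
    intro x hx
    have := eq_of_hasDerivAt_zero (f := fun x =>
      besselIntegral x * (p x + q x) - x * besselIntegralDeriv x * (φ x + ψ x)) hx
      ((hcJ.mul (h.cont_p.add h.cont_q)).sub
        (hcK.mul (h.cont_φ.add h.cont_ψ))).continuousOn (fun y hy => by
        have hy0 : y ≠ 0 := hy.1.ne'
        refine (((hasDerivAt_besselIntegral y).mul ((h.deriv_p y hy.1).add (h.deriv_q y hy.1))).sub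
          ((hasDerivAt_mul_besselIntegralDeriv y).mul
            ((h.deriv_φ y hy.1).add (h.deriv_ψ y hy.1)))).congr_deriv ?_
        simp only [Pi.add_apply, Real.rpow_one]
        field_simp
        ring)
    simpa [h.p_zero, h.q_zero] using this
  have hquot := eq_of_hasDerivAt_zero (f := fun x => (φ x + ψ x) / besselIntegral x) hr
    ((h.cont_φ.add h.cont_ψ).div hcJ fun x => (besselIntegral_pos x).ne').continuousOn
    (fun y hy => by
      have hy0 : y ≠ 0 := hy.1.ne'
      refine (((h.deriv_φ y hy.1).add (h.deriv_ψ y hy.1)).div (hasDerivAt_besselIntegral y)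
        (besselIntegral_pos y).ne').congr_deriv ?_
      rw [div_eq_zero_iff]
      left
      have := hW y hy.1.le
      simp only [Pi.add_apply]
      field_simp
      linarith)
  simp only [besselIntegral_zero] at hquot
  rw [← hquot, div_mul_cancel₀ _ (besselIntegral_pos r).ne']

/-- For `α = 1`, the function `z = φ - ψ` solves `Δ z = -z`, whose energy `z² + z'²` decreases. -/
lemma exists_abs_sub_le (h : RadialSystem 1 φ ψ p q) :
    ∃ C, ∀ r, 1 ≤ r → |φ r - ψ r| ≤ C := by
  refine ⟨√((φ 1 - ψ 1) ^ 2 + ((p 1 - q 1) / 1) ^ 2), fun r hr => Real.abs_le_sqrt ?_⟩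
  have hd : ∀ x, 0 < x → HasDerivAt (fun x => (φ x - ψ x) ^ 2 + ((p x - q x) / x) ^ 2)
      (-(2 * (p x - q x) ^ 2 / x ^ 3)) x := fun x hx => by
    have hx0 := hx.ne'
    refine ((((h.deriv_φ x hx).sub (h.deriv_ψ x hx)).pow 2).add
      ((((h.deriv_p x hx).sub (h.deriv_q x hx)).div (hasDerivAt_id x) hx.ne').pow 2)).congr_deriv ?_
    simp only [Pi.sub_apply, Pi.div_apply, id, Real.rpow_one]
    norm_num
    field_simp
    ring
  have key := sub_le_sub_of_hasDerivAt_le hr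
    (fun x hx => (hd x (by linarith [hx.1])).continuousAt.continuousWithinAt)
    (continuousOn_const (c := (0 : ℝ)))
    (fun x hx => hd x (by linarith [hx.1])) (fun x _ => hasDerivAt_const x (0 : ℝ))
    (fun x hx => by
      have : 0 < x := by linarith [hx.1]
      exact neg_nonpos.2 (by positivity))
  have : 0 ≤ ((p r - q r) / r) ^ 2 := sq_nonneg _
  linarith

lemma add_zero_ne_zero (h : RadialSystem 1 φ ψ p q) : φ 0 + ψ 0 ≠ 0 := by
  intro h0
  obtain ⟨r, hr, hψ⟩ := ((eventually_ge_atTop 0).and (h.tendsto_ψ.eventually_gt_atTop 0)).exists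
  have := h.add_eq_mul_besselIntegral hr
  rw [h0, zero_div, zero_mul] at this
  linarith [h.pos r]

theorem asymp_of_eq_one (h : RadialSystem 1 φ ψ p q) :
    AsympAtInfty φ fun r =>
        (φ 0 + ψ 0) * Real.Gamma ((2 : ℝ) / 2)
          * (2 : ℝ) ^ (((2 : ℝ) - 5) / 2) * Real.pi ^ (-(1 : ℝ) / 2)
          * r ^ (-((2 : ℝ) - 1) / 2) * Real.exp r := by
  have hV := h.add_zero_ne_zero
  obtain ⟨C, hC⟩ := h.exists_abs_sub_le
  have hdecay : Tendsto (fun r => √r * Real.exp (-r)) atTop (𝓝 0) := by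
    refine (tendsto_rpow_mul_exp_neg_mul_atTop_nhds_zero (1 / 2) 1 one_pos).congr fun r => ?_
    rw [Real.sqrt_eq_rpow, neg_one_mul]
  have hz : Tendsto (fun r => √r * Real.exp (-r) * (φ r - ψ r)) atTop (𝓝 0) := by
    refine squeeze_zero_norm' (a := fun r => √r * Real.exp (-r) * C) ?_ (by
      simpa using hdecay.mul_const C)
    filter_upwards [eventually_ge_atTop 1] with r hr
    rw [norm_mul, Real.norm_of_nonneg (by positivity)]
    exact mul_le_mul_of_nonneg_left (hC r hr) (by positivity)
  have hv := ((tendsto_besselIntegral.const_mul ((φ 0 + ψ 0) / Real.pi)).add hz).div_const 2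
  have hp12 : Real.pi ^ (-(1 : ℝ) / 2) = (√Real.pi)⁻¹ := by
    rw [Real.sqrt_eq_rpow, ← Real.rpow_neg Real.pi_pos.le]; norm_num
  have h232 : (2 : ℝ) ^ (((2 : ℝ) - 5) / 2) = (2 * √2)⁻¹ := by
    rw [show ((2 : ℝ) - 5) / 2 = -(1 / 2) - 1 by norm_num, Real.rpow_sub_one two_ne_zero,
      Real.rpow_neg (by norm_num), ← Real.sqrt_eq_rpow, mul_inv]
    ring
  set D := (φ 0 + ψ 0) * (2 * √2)⁻¹ * (√Real.pi)⁻¹ with hD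
  have hD0 : D ≠ 0 := by
    have : 0 < √Real.pi := Real.sqrt_pos.2 Real.pi_pos
    positivity
  have hDeq : ((φ 0 + ψ 0) / Real.pi * √(Real.pi / 2) + 0) / 2 = D := by
    have h1 : 0 < √Real.pi := Real.sqrt_pos.2 Real.pi_pos
    have h2 : Real.pi = √Real.pi * √Real.pi := (Real.mul_self_sqrt Real.pi_pos.le).symm
    rw [hD, Real.sqrt_div Real.pi_pos.le]
    nth_rewrite 1 [h2]
    field_simp
    ring
  rw [hDeq] at hv
  have hfin := hv.div_const D
  rw [div_self hD0] at hfin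
  refine hfin.congr' ?_
  filter_upwards [eventually_gt_atTop 0] with r hr
  have hr12 : r ^ (-((2 : ℝ) - 1) / 2) = (√r)⁻¹ := by
    rw [Real.sqrt_eq_rpow, ← Real.rpow_neg hr.le]; norm_num
  have hs : 0 < √r := Real.sqrt_pos.2 hr
  have hφ : φ r = ((φ 0 + ψ 0) / Real.pi * besselIntegral r + (φ r - ψ r)) / 2 := by
    rw [← h.add_eq_mul_besselIntegral hr.le]; ring
  rw [hp12, h232, hr12, div_self two_ne_zero, Real.Gamma_one, mul_one, ← hD, Real.exp_neg]
  rw [show φ r / (D * (√r)⁻¹ * Real.exp r) = φ r * (√r * (Real.exp r)⁻¹) / D by field_simp]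
  conv_rhs => rw [hφ]
  ring

end RadialSystem

theorem theorem2 (α : ℝ) (hα : α ≤ 1) (u : EuclideanSpace ℝ (Fin 2) → ℝ)
    (hu : IsPositiveRadialSolution 2 α u) :
    (α = 1 →
      AsympAtInfty (radialProfile u) (fun r =>
        (radialProfile u 0 + 2 * iteratedDeriv 2 (radialProfile u) 0) * Real.Gamma ((2 : ℝ) / 2)
          * (2 : ℝ) ^ (((2 : ℝ) - 5) / 2) * Real.pi ^ (-(1 : ℝ) / 2)
          * r ^ (-((2 : ℝ) - 1) / 2) * Real.exp r)) ∧
    (-1 < α → α < 1 →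
      AsympAtInfty (radialProfile u) (fun r =>
        ((2 + 4 * α / (1 - α)) * (2 + 4 * α / (1 - α) + 2)
            * (4 * α / (1 - α) + 2) * (4 * α / (1 - α) + 4)) ^ (-1 / (1 - α))
          * r ^ (4 / (1 - α)))) ∧
    (α = -1 →
      AsympAtInfty (radialProfile u) (fun r =>
        (2 : ℝ) ^ (-(1 : ℝ) / 2) * r ^ 2 * Real.log r
          * (Real.log (Real.log r)) ^ ((1 : ℝ) / 2))) ∧
    (α < -1 →
      MeasureTheory.IntegrableOn (fun t => t * radialProfile u t ^ α) (Set.Ioi 0) ∧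
      AsympAtInfty (radialProfile u) (fun r =>
        (1 / 4 * ∫ t in Set.Ioi (0 : ℝ), t * radialProfile u t ^ α) * r ^ 2 * Real.log r)) := by
  obtain ⟨ψ, p, q, h, h0⟩ := hu.exists_radialSystem
  refine ⟨?_, h.asymp_of_abs_lt_one, ?_, h.asymp_of_lt_neg_one⟩
  · rintro rfl
    rw [← h0]
    exact h.asymp_of_eq_one
  · rintro rfl
    exact h.asymp_of_eq_neg_one
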